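/- Let $(M,g,J)$ be an almost Hermitian 4-manifold: $M$ is a smooth 4-manifold, $g$ a smooth Riemannian metric and $J$ a smooth almost complex structure with $g(JX,JY)=g(X,Y)$; put $\Omega(X,Y)=g(JX,Y)$ and orient $M$ by $\Omega\wedge\Omega$. Let $\nabla$ be the Levi-Civita connection and let $R_{XYZW}=-g(\nabla_X\nabla_YZ-\nabla_Y\nabla_XZ-\nabla_{[X,Y]}Z,\,W)$ (so that $R_{XYXY}>0$ on round spheres). For a local orthonormal frame $(e_i)$ let $Ric(X,Y)=\sum_iR_{e_iXe_iY}$, let $s$ be the trace of $Ric$, and $Ric_0=Ric-\frac s4 g$. Curvature-type tensors act on 2-forms by $R(\phi)(X,Y)=\frac12\sum_{i,j}\phi(e_i,e_j)R_{e_ie_jXY}$, and $\langle\phi,\psi\rangle=\frac12\sum_{i,j}\phi(e_i,e_j)\psi(e_i,e_j)$. Let $s^*$ be the trace of $Ric^*(X,Y)=-R(\Omega)(JX,Y)$, let $\kappa=3\langle W^+(\Omega),\Omega\rangle$, where $W^+$ is the self-dual part of the Weyl tensor, and let $\theta=J\delta\Omega$ be the Lee form, that is $\theta(X)=-(\delta\Omega)(JX)$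 with $\delta\Omega=-\sum_i(\nabla_{e_i}\Omega)(e_i,\cdot)$. Assume the second curvature condition of Gray $$(G_2)\qquad R_{XYZW}-R_{JXJYZW}=R_{JXYJZW}+R_{JXYZJW}\quad\text{for all tangent vectors } X,Y,Z,W.$$ (a) Then $s-s^*$ is differentiable and $$d(s-s^*)-\kappa\,\theta=4\,Ric_0(\theta),$$ where $Ric_0(\theta)$ is the 1-form $X\mapsto Ric_0(\theta^\sharp,X)$ and $\theta^\sharp$ is the vector field dual to $\theta$. (b) If moreover $(M,g,J)$ is almost Kähler, i.e. $d\Omega=0$, then $|\nabla J|^2=2(s^*-s)$, where $|\nabla J|^2=\sum_{i,j}|(\nabla_{e_i}J)e_j|^2$, and if $M$ is connected this function is constant. -/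

import Mathlib

open Bundle FiberBundle VectorField Module
open scoped Manifold ContDiff Topology

noncomputable section

namespace AlmostHermitian

set_option linter.unusedSectionVars false
set_option linter.unusedSimpArgs false

section LeviCivita

variable {E : Type*} [NormedAddCommGroup E] [NormedSpace ℝ E]
  {H : Type*} [TopologicalSpace H] (I : ModelWithCorners ℝ E H)
  {M : Type*} [TopologicalSpace M] [ChartedSpace H M]

instance tangentSpace_finiteDimensional [FiniteDimensional ℝ E] (x : M) :
    FiniteDimensional ℝ (TangentSpace I x) :=
  inferInstanceAs (FiniteDimensional ℝ E)

variable [RiemannianBundle (fun x : M ↦ TangentSpace I x)]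

/-- The right-hand side of the Koszul formula. -/
def koszul (X Y Z : Π x : M, TangentSpace I x) (x : M) : ℝ :=
  mvfderiv I (fun y ↦ inner ℝ (Y y) (Z y)) x (X x)
    + mvfderiv I (fun y ↦ inner ℝ (X y) (Z y)) x (Y x)
    - mvfderiv I (fun y ↦ inner ℝ (X y) (Y y)) x (Z x)
    + inner ℝ (mlieBracket I X Y x) (Z x)
    - inner ℝ (mlieBracket I X Z x) (Y x)
    - inner ℝ (mlieBracket I Y Z x) (X x)

variable [FiniteDimensional ℝ E] [IsManifold I ∞ M]
  [IsContMDiffRiemannianBundle I ∞ E (fun x : M ↦ TangentSpace I x)]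

variable {I}

theorem mdifferentiableAt_inner {x : M} {X Y : Π x : M, TangentSpace I x}
    (hX : MDiffAt (T% X) x) (hY : MDiffAt (T% Y) x) :
    MDiffAt (fun y ↦ inner ℝ (X y) (Y y)) x :=
  MDifferentiableAt.inner_bundle (F := E) (E := fun x : M ↦ TangentSpace I x) hX hY

theorem koszul_tensorial_left {x : M} {Y Z : Π x : M, TangentSpace I x}
    (hY : MDiffAt (T% Y) x) (hZ : MDiffAt (T% Z) x) :
    TensorialAt I E (fun X ↦ koszul I X Y Z x) x where
  smul {f X} hf hX := by
    have hXZ : MDiffAt (fun y ↦ inner ℝ (X y) (Z y)) x := mdifferentiableAt_inner hX hZ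
    have hXY : MDiffAt (fun y ↦ inner ℝ (X y) (Y y)) x := mdifferentiableAt_inner hX hY
    simp only [koszul, Pi.smul_apply', inner_smul_left, mlieBracket_smul_left hf hX]
    simp [mvfderiv_fun_mul hf hXZ, mvfderiv_fun_mul hf hXY, inner_add_left, inner_smul_left,
      inner_smul_right]
    ring
  add {X X'} hX hX' := by
    have hXZ : MDiffAt (fun y ↦ inner ℝ (X y) (Z y)) x := mdifferentiableAt_inner hX hZ
    have hXY : MDiffAt (fun y ↦ inner ℝ (X y) (Y y)) x := mdifferentiableAt_inner hX hY
    have hXZ' : MDiffAt (fun y ↦ inner ℝ (X' y) (Z y)) x := mdifferentiableAt_inner hX' hZ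
    have hXY' : MDiffAt (fun y ↦ inner ℝ (X' y) (Y y)) x := mdifferentiableAt_inner hX' hY
    simp only [koszul, Pi.add_apply, inner_add_left, mlieBracket_add_left hX hX']
    simp [mvfderiv_fun_add hXZ hXZ', mvfderiv_fun_add hXY hXY', inner_add_left, inner_add_right]
    ring

theorem koszul_tensorial_right {x : M} {X Y : Π x : M, TangentSpace I x}
    (hX : MDiffAt (T% X) x) (hY : MDiffAt (T% Y) x) :
    TensorialAt I E (fun Z ↦ koszul I X Y Z x) x where
  smul {f Z} hf hZ := by
    have hXZ : MDiffAt (fun y ↦ inner ℝ (X y) (Z y)) x := mdifferentiableAt_inner hX hZ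
    have hYZ : MDiffAt (fun y ↦ inner ℝ (Y y) (Z y)) x := mdifferentiableAt_inner hY hZ
    simp only [koszul, Pi.smul_apply', inner_smul_right, mlieBracket_smul_right hf hZ]
    simp [mvfderiv_fun_mul hf hXZ, mvfderiv_fun_mul hf hYZ, inner_add_left, inner_smul_left,
      inner_smul_right]
    rw [real_inner_comm (Y x) (Z x), real_inner_comm (X x) (Z x)]
    ring
  add {Z Z'} hZ hZ' := by
    have hXZ : MDiffAt (fun y ↦ inner ℝ (X y) (Z y)) x := mdifferentiableAt_inner hX hZ
    have hYZ : MDiffAt (fun y ↦ inner ℝ (Y y) (Z y)) x := mdifferentiableAt_inner hY hZ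
    have hXZ' : MDiffAt (fun y ↦ inner ℝ (X y) (Z' y)) x := mdifferentiableAt_inner hX hZ'
    have hYZ' : MDiffAt (fun y ↦ inner ℝ (Y y) (Z' y)) x := mdifferentiableAt_inner hY hZ'
    simp only [koszul, Pi.add_apply, inner_add_right, mlieBracket_add_right hZ hZ']
    simp [mvfderiv_fun_add hXZ hXZ', mvfderiv_fun_add hYZ hYZ', inner_add_left, inner_add_right]
    ring

theorem koszul_add_middle {x : M} {X Y Y' Z : Π x : M, TangentSpace I x}
    (hX : MDiffAt (T% X) x) (hY : MDiffAt (T% Y) x) (hY' : MDiffAt (T% Y') x)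
    (hZ : MDiffAt (T% Z) x) :
    koszul I X (Y + Y') Z x = koszul I X Y Z x + koszul I X Y' Z x := by
  have hXY : MDiffAt (fun y ↦ inner ℝ (X y) (Y y)) x := mdifferentiableAt_inner hX hY
  have hYZ : MDiffAt (fun y ↦ inner ℝ (Y y) (Z y)) x := mdifferentiableAt_inner hY hZ
  have hXY' : MDiffAt (fun y ↦ inner ℝ (X y) (Y' y)) x := mdifferentiableAt_inner hX hY'
  have hYZ' : MDiffAt (fun y ↦ inner ℝ (Y' y) (Z y)) x := mdifferentiableAt_inner hY' hZ
  simp only [koszul, Pi.add_apply, inner_add_right, inner_add_left, mlieBracket_add_right hY hY',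
    mlieBracket_add_left hY hY']
  simp [mvfderiv_fun_add hXY hXY', mvfderiv_fun_add hYZ hYZ']
  ring

theorem koszul_smul_middle {x : M} {X Y Z : Π x : M, TangentSpace I x} {f : M → ℝ}
    (hf : MDiffAt f x)
    (hX : MDiffAt (T% X) x) (hY : MDiffAt (T% Y) x) (hZ : MDiffAt (T% Z) x) :
    koszul I X (f • Y) Z x =
      f x * koszul I X Y Z x + 2 * (mvfderiv I f x (X x) * inner ℝ (Y x) (Z x)) := by
  have hXY : MDiffAt (fun y ↦ inner ℝ (X y) (Y y)) x := mdifferentiableAt_inner hX hY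
  have hYZ : MDiffAt (fun y ↦ inner ℝ (Y y) (Z y)) x := mdifferentiableAt_inner hY hZ
  simp only [koszul, Pi.smul_apply', inner_smul_right, inner_smul_left,
    mlieBracket_smul_right hf hY, mlieBracket_smul_left hf hY]
  simp [mvfderiv_fun_mul hf hXY, mvfderiv_fun_mul hf hYZ, inner_add_left, inner_smul_left,
      inner_smul_right]
  rw [real_inner_comm (X x) (Y x)]
  ring

/-- For a vector field `Y` differentiable at `x`, the bilinear form
`(u, w) ↦ 2 g(∇_u Y, w)` on `T_x M`. -/
def koszulForm (Y : Π x : M, TangentSpace I x) (x : M) (hY : MDiffAt (T% Y) x) :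
    TangentSpace I x →L[ℝ] TangentSpace I x →L[ℝ] ℝ :=
  TensorialAt.mkHom₂ (I := I) (F := E) (F' := E) (fun X Z ↦ koszul I X Y Z x) x
    (fun _ hZ ↦ koszul_tensorial_left hY hZ) (fun _ hX ↦ koszul_tensorial_right hX hY)

open Classical in
/-- The vector `∇_v Y` at `x`, defined by the Koszul formula when `Y` is differentiable at `x`
(and `0` otherwise). -/
def leviCivitaFun (Y : Π x : M, TangentSpace I x) (x : M) :
    TangentSpace I x →L[ℝ] TangentSpace I x :=
  if hY : MDiffAt (T% Y) x then
    ∑ i, (1 / 2 : ℝ) • ((koszulForm Y x hY).flip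
      (stdOrthonormalBasis ℝ (TangentSpace I x) i)).smulRight
        (stdOrthonormalBasis ℝ (TangentSpace I x) i)
  else 0

theorem inner_leviCivitaFun {x : M} {X Y Z : Π x : M, TangentSpace I x}
    (hX : MDiffAt (T% X) x) (hY : MDiffAt (T% Y) x) (hZ : MDiffAt (T% Z) x) :
    inner ℝ (leviCivitaFun Y x (X x)) (Z x) = (1 / 2) * koszul I X Y Z x := by
  have h : koszulForm Y x hY (X x) (Z x) = koszul I X Y Z x :=
    TensorialAt.mkHom₂_apply _ _ hX hZ
  rw [← h]
  conv_rhs => rw [← (stdOrthonormalBasis ℝ (TangentSpace I x)).sum_repr' (Z x)]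
  simp only [leviCivitaFun, hY, dite_true, map_sum, map_smul]
  simp [sum_inner, inner_smul_left, Finset.mul_sum]
  refine Finset.sum_congr rfl fun i _ ↦ ?_
  ring

theorem leviCivitaFun_eq_of_inner {x : M} {L L' : TangentSpace I x →L[ℝ] TangentSpace I x}
    (h : ∀ X Z : Π x : M, TangentSpace I x, MDiffAt (T% X) x → MDiffAt (T% Z) x →
      inner ℝ (L (X x)) (Z x) = inner ℝ (L' (X x)) (Z x)) : L = L' := by
  ext v
  refine ext_inner_right ℝ fun w ↦ ?_
  simpa using h (extend E v) (extend E w) (mdifferentiableAt_extend I E v)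
    (mdifferentiableAt_extend I E w)

variable (I M) in
/-- The Levi-Civita connection of the Riemannian metric; `leviCivita I M Y x v` is `∇_v Y`. -/
def leviCivita : CovariantDerivative I E (TangentSpace I : M → Type _) where
  toFun := leviCivitaFun
  isCovariantDerivativeOnUniv :=
    { add := fun {Y Y' x} hY hY' _ ↦ by
        have hYY' : MDiffAt (T% (Y + Y')) x := mdifferentiableAt_add_section hY hY'
        refine leviCivitaFun_eq_of_inner fun X Z hX hZ ↦ ?_
        rw [inner_leviCivitaFun hX hYY' hZ, add_apply, inner_add_left,
          inner_leviCivitaFun hX hY hZ, inner_leviCivitaFun hX hY' hZ,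
          koszul_add_middle hX hY hY' hZ]
        ring
      leibniz := fun {Y f x} hY hf _ ↦ by
        have hfY : MDiffAt (T% (f • Y)) x := hf.smul_section hY
        refine leviCivitaFun_eq_of_inner fun X Z hX hZ ↦ ?_
        rw [inner_leviCivitaFun hX hfY hZ, add_apply, inner_add_left,
          smul_apply, inner_smul_left, inner_leviCivitaFun hX hY hZ,
          koszul_smul_middle hf hX hY hZ, ContinuousLinearMap.smulRight_apply, inner_smul_left]
        simp
        ring }

/-- The Levi-Civita connection is metric. -/
theorem leviCivita_metric {x : M} {X Y Z : Π x : M, TangentSpace I x}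
    (hX : MDiffAt (T% X) x) (hY : MDiffAt (T% Y) x) (hZ : MDiffAt (T% Z) x) :
    mvfderiv I (fun y ↦ inner ℝ (Y y) (Z y)) x (X x) =
      inner ℝ (leviCivita I M Y x (X x)) (Z x) + inner ℝ (Y x) (leviCivita I M Z x (X x)) := by
  rw [real_inner_comm (leviCivita I M Z x (X x)) (Y x)]
  change _ = inner ℝ (leviCivitaFun Y x (X x)) (Z x) + inner ℝ (leviCivitaFun Z x (X x)) (Y x)
  rw [inner_leviCivitaFun hX hY hZ, inner_leviCivitaFun hX hZ hY]
  have hs : ∀ A B : Π x : M, TangentSpace I x,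
      (fun y ↦ inner ℝ (A y) (B y)) = fun y ↦ inner ℝ (B y) (A y) :=
    fun A B ↦ funext fun y ↦ real_inner_comm _ _
  simp only [koszul, hs Z Y, mlieBracket_swap_apply (V := Z) (W := Y), inner_neg_left]
  ring

/-- The Levi-Civita connection is torsion-free. -/
theorem leviCivita_torsionFree {x : M} {X Y : Π x : M, TangentSpace I x}
    (hX : MDiffAt (T% X) x) (hY : MDiffAt (T% Y) x) :
    leviCivita I M Y x (X x) - leviCivita I M X x (Y x) = mlieBracket I X Y x := by
  refine ext_inner_right ℝ fun w ↦ ?_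
  have hZ := mdifferentiableAt_extend I E w
  have h1 := inner_leviCivitaFun hX hY hZ
  have h2 := inner_leviCivitaFun hY hX hZ
  have hs : (fun y ↦ inner ℝ (Y y) (X y)) = fun y ↦ inner ℝ (X y) (Y y) :=
    funext fun y ↦ real_inner_comm _ _
  simp only [extend_apply_self] at h1 h2
  rw [inner_sub_left]
  change inner ℝ (leviCivitaFun Y x (X x)) w - inner ℝ (leviCivitaFun X x (Y x)) w = _
  rw [h1, h2]
  simp only [koszul, hs, mlieBracket_swap_apply (V := Y) (W := X), inner_neg_left,
    extend_apply_self]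
  ring

end LeviCivita

section Curvature

variable {E : Type*} [NormedAddCommGroup E] [NormedSpace ℝ E]
  {H : Type*} [TopologicalSpace H] (I : ModelWithCorners ℝ E H)
  {M : Type*} [TopologicalSpace M] [ChartedSpace H M]
  [RiemannianBundle (fun x : M ↦ TangentSpace I x)]
  [FiniteDimensional ℝ E] [IsManifold I ∞ M]
  [IsContMDiffRiemannianBundle I ∞ E (fun x : M ↦ TangentSpace I x)]

/-- An orthonormal basis of `T_x M`, used to write traces. -/
abbrev frame (x : M) :
    OrthonormalBasis (Fin (finrank ℝ (TangentSpace I x))) ℝ (TangentSpace I x) :=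
  stdOrthonormalBasis ℝ (TangentSpace I x)

/-- `∇_U ∇_V W - ∇_V ∇_U W - ∇_{[U, V]} W` at `x`, for local vector fields `U`, `V`, `W` that are
smooth near `x` and extend `u`, `v`, `w`. -/
def curvatureEndo (x : M) (u v w : TangentSpace I x) : TangentSpace I x :=
  leviCivita I M (fun y ↦ leviCivita I M (extend E w) y (extend E v y)) x u
    - leviCivita I M (fun y ↦ leviCivita I M (extend E w) y (extend E u y)) x v
    - leviCivita I M (extend E w) x (mlieBracket I (extend E u) (extend E v) x)

/-- The Riemannian curvature tensor `R_{XYZW}`, with the sign for which `R_{XYXY} > 0` on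
spheres. -/
def riem (x : M) (X Y Z W : TangentSpace I x) : ℝ :=
  -inner ℝ (curvatureEndo I x X Y Z) W

/-- The Ricci tensor. -/
def ric (x : M) (X Y : TangentSpace I x) : ℝ :=
  ∑ i, riem I x (frame I x i) X (frame I x i) Y

/-- The scalar curvature `s`. -/
def scal (x : M) : ℝ :=
  ∑ i, ric I x (frame I x i) (frame I x i)

/-- The traceless Ricci tensor `Ric₀` in dimension four. -/
def ricZero (x : M) (X Y : TangentSpace I x) : ℝ :=
  ric I x X Y - scal I x / 4 * inner ℝ X Y

/-- The inner product of two 2-forms at `x`, half of the tensor inner product. -/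
def formInner (x : M) (φ ψ : TangentSpace I x → TangentSpace I x → ℝ) : ℝ :=
  (1 / 2) * ∑ i, ∑ j, φ (frame I x i) (frame I x j) * ψ (frame I x i) (frame I x j)

/-- The endomorphism of 2-forms at `x` defined by a curvature-like tensor `T`: it sends (the 2-form
dual to) `X ∧ Y` to `T(X, Y, ·, ·)`. -/
def curvOp (x : M)
    (T : TangentSpace I x → TangentSpace I x → TangentSpace I x → TangentSpace I x → ℝ)
    (φ : TangentSpace I x → TangentSpace I x → ℝ) (X Y : TangentSpace I x) : ℝ :=
  (1 / 2) * ∑ i, ∑ j, φ (frame I x i) (frame I x j) * T (frame I x i) (frame I x j) X Y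

/-- The Kulkarni-Nomizu product of two symmetric bilinear forms. -/
def kulkarniNomizu {x : M} (h k : TangentSpace I x → TangentSpace I x → ℝ)
    (X Y Z W : TangentSpace I x) : ℝ :=
  h X Z * k Y W + h Y W * k X Z - h X W * k Y Z - h Y Z * k X W

/-- The Weyl tensor in dimension four:
`R = (s / 24) g ∧ g + (1 / 2) Ric₀ ∧ g + W` with Kulkarni-Nomizu products. -/
def weyl (x : M) (X Y Z W : TangentSpace I x) : ℝ :=
  riem I x X Y Z W
    - scal I x / 24 * kulkarniNomizu I (fun a b ↦ inner ℝ a b) (fun a b ↦ inner ℝ a b) X Y Z W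
    - (1 / 2) * kulkarniNomizu I (ricZero I x) (fun a b ↦ inner ℝ a b) X Y Z W

end Curvature

section Hermitian

variable {E : Type*} [NormedAddCommGroup E] [NormedSpace ℝ E]
  {H : Type*} [TopologicalSpace H] {I : ModelWithCorners ℝ E H}
  {M : Type*} [TopologicalSpace M] [ChartedSpace H M]
  [RiemannianBundle (fun x : M ↦ TangentSpace I x)]
  [FiniteDimensional ℝ E] [IsManifold I ∞ M]
  [IsContMDiffRiemannianBundle I ∞ E (fun x : M ↦ TangentSpace I x)]
  (J : Π x : M, TangentSpace I x →L[ℝ] TangentSpace I x)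

/-- `J` is a smooth almost complex structure, orthogonal for the Riemannian metric. -/
structure IsAlmostHermitian : Prop where
  contMDiff : ContMDiff I (I.prod 𝓘(ℝ, E →L[ℝ] E)) ∞
    (fun x : M ↦ TotalSpace.mk' (E →L[ℝ] E)
      (E := fun x : M ↦ TangentSpace I x →L[ℝ] TangentSpace I x) x (J x))
  apply_apply : ∀ (x : M) (X : TangentSpace I x), J x (J x X) = -X
  inner_apply_apply : ∀ (x : M) (X Y : TangentSpace I x),
    inner ℝ (J x X) (J x Y) = inner ℝ X Y

/-- The fundamental 2-form `Ω(X, Y) = g(JX, Y)`. -/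
def fundForm (x : M) (X Y : TangentSpace I x) : ℝ :=
  inner ℝ (J x X) Y

/-- The exterior derivative `dΩ(X, Y, Z)` evaluated on vector fields, at `x`. -/
def dFundForm (X Y Z : Π x : M, TangentSpace I x) (x : M) : ℝ :=
  mvfderiv I (fun y ↦ fundForm J y (Y y) (Z y)) x (X x)
    - mvfderiv I (fun y ↦ fundForm J y (X y) (Z y)) x (Y x)
    + mvfderiv I (fun y ↦ fundForm J y (X y) (Y y)) x (Z x)
    - fundForm J x (mlieBracket I X Y x) (Z x)
    + fundForm J x (mlieBracket I X Z x) (Y x)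
    - fundForm J x (mlieBracket I Y Z x) (X x)

/-- An almost Hermitian structure is almost Kähler when `dΩ = 0`. -/
structure IsAlmostKahler : Prop extends IsAlmostHermitian J where
  closed : ∀ (x : M) (X Y Z : Π x : M, TangentSpace I x),
    MDiffAt (T% X) x → MDiffAt (T% Y) x → MDiffAt (T% Z) x → dFundForm J X Y Z x = 0

/-- The covariant derivative `(∇_u J) v`. -/
def nablaJ (x : M) (u v : TangentSpace I x) : TangentSpace I x :=
  leviCivita I M (fun y ↦ J y (extend E v y)) x u - J x (leviCivita I M (extend E v) x u)

/-- `|∇J|²`, the squared tensor norm. -/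
def normSqNablaJ (x : M) : ℝ :=
  ∑ i, ∑ j, ‖nablaJ J x (frame I x i) (frame I x j)‖ ^ 2

/-- The covariant derivative `(∇_u Ω)(v, w)`. -/
def nablaFundForm (x : M) (u v w : TangentSpace I x) : ℝ :=
  mvfderiv I (fun y ↦ fundForm J y (extend E v y) (extend E w y)) x u
    - fundForm J x (leviCivita I M (extend E v) x u) w
    - fundForm J x v (leviCivita I M (extend E w) x u)

/-- The codifferential `δΩ`. -/
def codiffFundForm (x : M) (X : TangentSpace I x) : ℝ :=
  -∑ i, nablaFundForm J x (frame I x i) (frame I x i) X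

/-- The Lee form `θ = J δΩ`, where `(Jα)(X) = -α(JX)`. -/
def leeForm (x : M) (X : TangentSpace I x) : ℝ :=
  -codiffFundForm J x (J x X)

/-- The vector metrically dual to the Lee form. -/
def leeVector (x : M) : TangentSpace I x :=
  ∑ i, leeForm J x (frame I x i) • frame I x i

/-- The star-Ricci tensor `Ric*(X, Y) = -R(Ω)(JX, Y)`. -/
def ricStar (x : M) (X Y : TangentSpace I x) : ℝ :=
  -curvOp I x (riem I x) (fundForm J x) (J x X) Y

/-- The star-scalar curvature `s*`. -/
def scalStar (x : M) : ℝ :=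
  ∑ i, ricStar J x (frame I x i) (frame I x i)

/-- In dimension four, the volume form `(1 / 2) Ω ∧ Ω` of the orientation given by `J`. -/
def volForm (x : M) (X Y Z W : TangentSpace I x) : ℝ :=
  fundForm J x X Y * fundForm J x Z W - fundForm J x X Z * fundForm J x Y W
    + fundForm J x X W * fundForm J x Y Z

/-- The Hodge star operator on 2-forms, in dimension four. -/
def hodgeStar (x : M) (φ : TangentSpace I x → TangentSpace I x → ℝ) (X Y : TangentSpace I x) : ℝ :=
  (1 / 2) * ∑ i, ∑ j, φ (frame I x i) (frame I x j) * volForm J x (frame I x i) (frame I x j) X Y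

/-- The self-dual part of a 2-form. -/
def selfDualPart (x : M) (φ : TangentSpace I x → TangentSpace I x → ℝ)
    (X Y : TangentSpace I x) : ℝ :=
  (1 / 2) * (φ X Y + hodgeStar J x φ X Y)

/-- The self-dual Weyl tensor `W⁺` as an endomorphism of 2-forms. -/
def weylPlus (x : M) (φ : TangentSpace I x → TangentSpace I x → ℝ) :
    TangentSpace I x → TangentSpace I x → ℝ :=
  selfDualPart J x (curvOp I x (weyl I x) (selfDualPart J x φ))

/-- The conformal scalar curvature `κ = 3 ⟨W⁺(Ω), Ω⟩`. -/
def conformalScal (x : M) : ℝ :=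
  3 * formInner I x (weylPlus J x (fundForm J x)) (fundForm J x)

/-- The second curvature condition of Gray:
`R_{XYZW} - R_{JXJYZW} = R_{JXYJZW} + R_{JXYZJW}`. -/
def SatisfiesG2 : Prop :=
  ∀ (x : M) (X Y Z W : TangentSpace I x),
    riem I x X Y Z W - riem I x (J x X) (J x Y) Z W
      = riem I x (J x X) Y (J x Z) W + riem I x (J x X) Y Z (J x W)

end Hermitian

end AlmostHermitian

end

open AlmostHermitian

noncomputable section

set_option linter.unusedSectionVars false
set_option linter.style.haveILetI false

/-! Work in a local orthonormal frame e₀, e₁ = Je₀, e₂, e₃ = Je₂. There Ω = e₀∧e₁ + e₂∧e₃, and the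
J-anti-invariant 2-forms are spanned by φ = e₀∧e₂ − e₁∧e₃ and ψ = e₀∧e₃ + e₁∧e₂; these three forms
span the self-dual forms. Since J is orthogonal, ∇Ω = C ⊗ φ − B ⊗ ψ for two local 1-forms B and C
(`nablaFundForm_frame_eq`), and θ is a J-twisted combination of B and C (`leeForm_eq`).

Gray's condition makes the curvature operator preserve the plane of φ and ψ and commute with the
rotation that J induces on it. The operator is symmetric, so it is a scalar λ (`antiCurv`) on that
plane (`riemComp_phi`, `riemComp_psi`). The operator has trace s/4 on self-dual forms and Ω
contributes s*/4, whence s − s* = 8λ (`scal_sub_scalStar`). This already gives differentiability.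

For (a), pair the second Bianchi identity with φ and with ψ. The covariant derivative of φ has a
ψ-component and an Ω-component. The ψ-component drops out because φ and ψ have the same eigenvalue;
the Ω-component leaves dλ∧φ equal, up to sign, to C∧(R(Ω) − λΩ). Likewise dλ∧ψ is controlled by
B∧(R(Ω) − λΩ). The self-dual part of R(Ω) − λΩ is (s*/4 − λ)Ω = (κ/4)Ω, because κ = (3s* − s)/2
(`conformalScal_eq`); its anti-self-dual part comes from Ric₀. Adding the two identities turns B and
C into θ and gives the formula (`frameDeriv_antiCurv`).

For (b), dΩ = 0 expresses C through B and forces θ = 0, so (a) says that s − s* has zero derivative.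
The value of |∇J|² comes from the structure equations: in ⟨R(φ), φ⟩ + ⟨R(ψ), ψ⟩ = 4λ the derivative
terms cancel by the derivatives of the relations between B and C, and the quadratic terms leave a
multiple of |B|² (`normSqNablaJ_eq_antiCurv`). -/

namespace AlmostHermitian

/-! ### Smooth fields and functions on open sets; brackets as commutators of derivations. -/

section SmoothFields

variable {E : Type*} [NormedAddCommGroup E] [NormedSpace ℝ E]
  {H : Type*} [TopologicalSpace H] {I : ModelWithCorners ℝ E H}
  {M : Type*} [TopologicalSpace M] [ChartedSpace H M] [IsManifold I ∞ M]

/-- The vector field `X` is smooth at every point of `U`. -/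
def SmoothFieldOn (U : Set M) (X : Π x : M, TangentSpace I x) : Prop :=
  ∀ y ∈ U, ContMDiffAt I (I.prod 𝓘(ℝ, E)) ∞ (T% X) y

variable (I) in
/-- The function `f` is smooth at every point of `U`. -/
def SmoothFunOn (U : Set M) (f : M → ℝ) : Prop :=
  ∀ y ∈ U, ContMDiffAt I 𝓘(ℝ, ℝ) ∞ f y

theorem SmoothFunOn.mdiffAt {U : Set M} {f : M → ℝ} (hf : SmoothFunOn I U f) {y : M}
    (hy : y ∈ U) : MDiffAt f y :=
  (hf y hy).mdifferentiableAt (by simp)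

theorem SmoothFunOn.add {U : Set M} {f g : M → ℝ} (hf : SmoothFunOn I U f)
    (hg : SmoothFunOn I U g) : SmoothFunOn I U (fun y ↦ f y + g y) :=
  fun y hy ↦ (hf y hy).add (hg y hy)

theorem SmoothFunOn.sub {U : Set M} {f g : M → ℝ} (hf : SmoothFunOn I U f)
    (hg : SmoothFunOn I U g) : SmoothFunOn I U (fun y ↦ f y - g y) :=
  fun y hy ↦ (hf y hy).sub (hg y hy)

theorem SmoothFunOn.mul {U : Set M} {f g : M → ℝ} (hf : SmoothFunOn I U f)
    (hg : SmoothFunOn I U g) : SmoothFunOn I U (fun y ↦ f y * g y) :=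
  fun y hy ↦ (hf y hy).mul (hg y hy)

theorem SmoothFunOn.congr {U : Set M} (hU : IsOpen U) {f g : M → ℝ} (hf : SmoothFunOn I U f)
    (h : ∀ y ∈ U, g y = f y) : SmoothFunOn I U g :=
  fun y hy ↦ (hf y hy).congr_of_eventuallyEq (Filter.eventually_of_mem (hU.mem_nhds hy) h)

theorem SmoothFieldOn.congr {U : Set M} (hU : IsOpen U) {X Y : Π x : M, TangentSpace I x}
    (hX : SmoothFieldOn U X) (h : ∀ y ∈ U, Y y = X y) : SmoothFieldOn U Y :=
  fun y hy ↦ (hX y hy).congr_of_eventuallyEq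
    (Filter.eventually_of_mem (hU.mem_nhds hy) fun z hz ↦ by simp [h z hz])

theorem SmoothFieldOn.mono {U V : Set M} {X : Π x : M, TangentSpace I x}
    (hX : SmoothFieldOn U X) (h : V ⊆ U) : SmoothFieldOn V X :=
  fun y hy ↦ hX y (h hy)

theorem SmoothFunOn.const {U : Set M} (a : ℝ) : SmoothFunOn I U (fun _ ↦ a) :=
  fun _ _ ↦ contMDiffAt_const

theorem SmoothFieldOn.mdiffAt {U : Set M} {X : Π x : M, TangentSpace I x}
    (hX : SmoothFieldOn U X) {y : M} (hy : y ∈ U) : MDiffAt (T% X) y :=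
  (hX y hy).mdifferentiableAt (by simp)

theorem SmoothFieldOn.sub {U : Set M} {X Y : Π x : M, TangentSpace I x}
    (hX : SmoothFieldOn U X) (hY : SmoothFieldOn U Y) : SmoothFieldOn U (X - Y) :=
  fun y hy ↦ (hX y hy).sub_section (hY y hy)

theorem SmoothFieldOn.smul {U : Set M} {f : M → ℝ} {X : Π x : M, TangentSpace I x}
    (hf : SmoothFunOn I U f) (hX : SmoothFieldOn U X) : SmoothFieldOn U (f • X) :=
  fun y hy ↦ (hf y hy).smul_section (hX y hy)

theorem exists_smoothFieldOn_extend (x : M) (v : TangentSpace I x) :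
    ∃ U : Set M, IsOpen U ∧ x ∈ U ∧ SmoothFieldOn (I := I) U (extend E v) := by
  obtain ⟨s, hs, h⟩ := exists_contMDiffOn_extend (k := ∞) I E (V := fun x : M ↦ TangentSpace I x) v
  obtain ⟨U, hUs, hU, hx⟩ := mem_nhds_iff.1 hs
  exact ⟨U, hU, hx, fun y hy ↦ (h.mono hUs).contMDiffAt (hU.mem_nhds hy)⟩

theorem isManifold_nat (n : ℕ) : IsManifold I n M :=
  IsManifold.of_le (n := ∞) (by exact_mod_cast le_top)

variable [CompleteSpace E]

theorem SmoothFieldOn.bracket {U : Set M} {X Y : Π x : M, TangentSpace I x}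
    (hX : SmoothFieldOn U X) (hY : SmoothFieldOn U Y) :
    SmoothFieldOn U (mlieBracket I X Y) := fun y hy ↦ by
  haveI : IsManifold I (minSmoothness ℝ 2) M := by
    simpa using isManifold_nat (I := I) (M := M) 2
  haveI : IsManifold I (((⊤ : ℕ∞) : WithTop ℕ∞) + 1) M := ‹IsManifold I ∞ M›
  exact ContMDiffAt.mlieBracket_vectorField (𝕜 := ℝ) (n := ⊤) (m := ⊤) (hX y hy) (hY y hy) (by simp)

/-- The Jacobi identity in cyclic form. -/
theorem mlieBracket_jacobi {U : Set M} {X Y Z : Π x : M, TangentSpace I x}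
    (hX : SmoothFieldOn U X) (hY : SmoothFieldOn U Y) (hZ : SmoothFieldOn U Z) {y : M}
    (hy : y ∈ U) :
    mlieBracket I X (mlieBracket I Y Z) y =
      mlieBracket I (mlieBracket I X Y) Z y +
        mlieBracket I Y (mlieBracket I X Z) y := by
  haveI : IsManifold I (minSmoothness ℝ 3) M := by
    simpa using isManifold_nat (I := I) (M := M) 3
  have h2 : ((minSmoothness ℝ 2 : WithTop ℕ∞)) ≤ ∞ := by
    simpa using (show ((2 : ℕ∞) : WithTop ℕ∞) ≤ ∞ from WithTop.coe_le_coe.2 le_top)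
  exact leibniz_identity_mlieBracket_apply ((hX y hy).of_le h2) ((hY y hy).of_le h2)
    ((hZ y hy).of_le h2)

variable [RiemannianBundle (fun x : M ↦ TangentSpace I x)]
  [IsContMDiffRiemannianBundle I ∞ E (fun x : M ↦ TangentSpace I x)]

theorem SmoothFieldOn.inner_bundle {U : Set M} {X Y : Π x : M, TangentSpace I x}
    (hX : SmoothFieldOn U X) (hY : SmoothFieldOn U Y) :
    SmoothFunOn I U (fun y ↦ inner ℝ (X y) (Y y)) :=
  fun y hy ↦ ContMDiffAt.inner_bundle (IB := I) (n := ∞) (F := E) (E := fun x : M ↦ TangentSpace I x)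
    (hX y hy) (hY y hy)

/-- The derivative of a smooth function along a smooth field is smooth, on an open set that
carries a smooth field of unit length. -/
theorem SmoothFunOn.deriv {U : Set M} (hU : IsOpen U) {f : M → ℝ} {X Z : Π x : M, TangentSpace I x}
    (hf : SmoothFunOn I U f) (hX : SmoothFieldOn U X) (hZ : SmoothFieldOn U Z)
    (h1 : ∀ y ∈ U, inner ℝ (Z y) (Z y) = (1 : ℝ)) :
    SmoothFunOn I U (fun y ↦ mvfderiv I f y (X y)) := by
  -- By the Leibniz rule [X, fZ] − f[X, Z] = X(f) Z, and pairing with the unit field Z recovers X(f)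
  -- from smooth ingredients.
  refine SmoothFunOn.congr hU (f := fun y ↦
    inner ℝ ((mlieBracket I X (f • Z) - f • mlieBracket I X Z) y) (Z y))
    (((hX.bracket (hZ.smul hf)).sub ((hX.bracket hZ).smul hf)).inner_bundle hZ) fun y hy ↦ ?_
  simp only [Pi.sub_apply, mlieBracket_smul_right (hf.mdiffAt hy) (hZ.mdiffAt hy),
    Pi.smul_apply', add_sub_cancel_right, inner_smul_left, h1 y hy]
  simp

theorem mvfderiv_congr {U : Set M} (hU : IsOpen U) {f g : M → ℝ} (h : ∀ y ∈ U, f y = g y)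
    {y : M} (hy : y ∈ U) : mvfderiv I f y = mvfderiv I g y := by
  have hfg : f =ᶠ[𝓝 y] g := Filter.eventually_of_mem (hU.mem_nhds hy) h
  have := hfg.mfderiv_eq (I := I) (I' := 𝓘(ℝ, ℝ))
  ext v
  simp only [mvfderiv, this]
  rfl

theorem mlieBracket_congr {U : Set M} (hU : IsOpen U) {X X' Y Y' : Π x : M, TangentSpace I x}
    (hX : ∀ y ∈ U, X y = X' y) (hY : ∀ y ∈ U, Y y = Y' y) {y : M} (hy : y ∈ U) :
    mlieBracket I X Y y = mlieBracket I X' Y' y :=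
  Filter.EventuallyEq.mlieBracket_vectorField_eq
    (Filter.eventually_of_mem (hU.mem_nhds hy) hX) (Filter.eventually_of_mem (hU.mem_nhds hy) hY)

/-- The Lie bracket acts on functions as the commutator of derivations. -/
theorem mvfderiv_mlieBracket {U : Set M} (hU : IsOpen U) {f : M → ℝ}
    {X Y Z : Π x : M, TangentSpace I x}
    (hf : SmoothFunOn I U f) (hX : SmoothFieldOn U X) (hY : SmoothFieldOn U Y)
    (hZ : SmoothFieldOn U Z) (h1 : ∀ y ∈ U, inner ℝ (Z y) (Z y) = (1 : ℝ)) {y : M} (hy : y ∈ U) :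
    mvfderiv I f y (mlieBracket I X Y y) =
      mvfderiv I (fun z ↦ mvfderiv I f z (Y z)) y (X y) -
        mvfderiv I (fun z ↦ mvfderiv I f z (X z)) y (Y y) := by
  -- The Jacobi identity is applied to X, Y and fZ. After expansion, the terms that do not
  -- differentiate f twice or along [X, Y] cancel, leaving ([X, Y]f − X(Yf) + Y(Xf)) Z = 0 with Z
  -- nowhere zero.
  have key : ∀ {A B : Π x : M, TangentSpace I x}, SmoothFieldOn U A → SmoothFieldOn U B →
      mlieBracket I A (mlieBracket I B (f • Z)) y =
        (mvfderiv I (fun z ↦ mvfderiv I f z (B z)) y (A y) • Z y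
          + mvfderiv I f y (B y) • mlieBracket I A Z y)
        + (mvfderiv I f y (A y) • mlieBracket I B Z y
          + f y • mlieBracket I A (mlieBracket I B Z) y) := by
    intro A B hA hB
    have hfB : SmoothFunOn I U (fun z ↦ mvfderiv I f z (B z)) := hf.deriv hU hB hZ h1
    have e1 := mlieBracket_congr (X := A) (X' := A) (Y := mlieBracket I B (f • Z))
      (Y' := (fun z ↦ mvfderiv I f z (B z)) • Z + f • mlieBracket I B Z) hU
      (fun _ _ ↦ rfl) (fun z hz ↦ mlieBracket_smul_right (hf.mdiffAt hz) (hZ.mdiffAt hz)) hy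
    rw [e1, mlieBracket_add_right ((hZ.smul hfB).mdiffAt hy)
      (((hB.bracket hZ).smul hf).mdiffAt hy),
      mlieBracket_smul_right (hfB.mdiffAt hy) (hZ.mdiffAt hy),
      mlieBracket_smul_right (hf.mdiffAt hy) ((hB.bracket hZ).mdiffAt hy)]
  have hj := mlieBracket_jacobi hX hY (hZ.smul hf) hy
  rw [key hX hY, key hY hX, mlieBracket_smul_right (hf.mdiffAt hy) (hZ.mdiffAt hy),
    mlieBracket_jacobi hX hY hZ hy] at hj
  have hj2 : (mvfderiv I f y (mlieBracket I X Y y)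
      - (mvfderiv I (fun z ↦ mvfderiv I f z (Y z)) y (X y) -
        mvfderiv I (fun z ↦ mvfderiv I f z (X z)) y (Y y))) • Z y = 0 := by
    linear_combination (norm := module) -hj
  have hZ0 : Z y ≠ 0 := fun h ↦ by simpa [h] using h1 y hy
  rcases smul_eq_zero.1 hj2 with h | h
  · linarith
  · exact absurd h hZ0

end SmoothFields

/-! ### The Levi-Civita connection on smooth fields, and the Bianchi identities. -/

section Connection

variable {E : Type*} [NormedAddCommGroup E] [NormedSpace ℝ E]
  {H : Type*} [TopologicalSpace H] {I : ModelWithCorners ℝ E H}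
  {M : Type*} [TopologicalSpace M] [ChartedSpace H M] [IsManifold I ∞ M]
  [RiemannianBundle (fun x : M ↦ TangentSpace I x)]
  [FiniteDimensional ℝ E]
  [IsContMDiffRiemannianBundle I ∞ E (fun x : M ↦ TangentSpace I x)]

/-- A smooth orthonormal frame with four members over an open set `U`. -/
structure IsOrthoFrameOn (U : Set M) (e : Fin 4 → Π x : M, TangentSpace I x) : Prop where
  isOpen : IsOpen U
  smooth : ∀ i, SmoothFieldOn U (e i)
  basis : ∀ y ∈ U, ∃ b : OrthonormalBasis (Fin 4) ℝ (TangentSpace I y), ∀ i, b i = e i y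

theorem IsOrthoFrameOn.mono {U V : Set M} {e : Fin 4 → Π x : M, TangentSpace I x}
    (he : IsOrthoFrameOn U e) (hV : IsOpen V) (h : V ⊆ U) : IsOrthoFrameOn V e :=
  ⟨hV, fun i ↦ (he.smooth i).mono h, fun y hy ↦ he.basis y (h hy)⟩

theorem IsOrthoFrameOn.inner_eq {U : Set M} {e : Fin 4 → Π x : M, TangentSpace I x}
    (he : IsOrthoFrameOn U e) {y : M} (hy : y ∈ U) (i j : Fin 4) :
    inner ℝ (e i y) (e j y) = if i = j then (1 : ℝ) else 0 := by
  obtain ⟨b, hb⟩ := he.basis y hy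
  rw [← hb, ← hb]
  exact orthonormal_iff_ite.1 b.orthonormal i j

theorem IsOrthoFrameOn.sum_inner_smul {U : Set M} {e : Fin 4 → Π x : M, TangentSpace I x}
    (he : IsOrthoFrameOn U e) {y : M} (hy : y ∈ U) (v : TangentSpace I y) :
    ∑ i, (inner ℝ v (e i y) : ℝ) • e i y = v := by
  obtain ⟨b, hb⟩ := he.basis y hy
  simpa [← hb, real_inner_comm] using b.sum_repr' v

theorem IsOrthoFrameOn.inner_zero {U : Set M} {e : Fin 4 → Π x : M, TangentSpace I x}
    (he : IsOrthoFrameOn U e) : ∀ y ∈ U, inner ℝ (e 0 y) (e 0 y) = (1 : ℝ) :=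
  fun y hy ↦ by simpa using he.inner_eq hy 0 0

theorem SmoothFieldOn.sum {U : Set M} {ι : Type*} {s : Finset ι} {X : ι → Π x : M, TangentSpace I x}
    (hX : ∀ i, SmoothFieldOn U (X i)) : SmoothFieldOn U (fun y ↦ ∑ i ∈ s, X i y) :=
  fun y hy ↦ ContMDiffAt.sum_section fun i _ ↦ hX i y hy

/-- The vector field `∇_X Y`. -/
def covDeriv (X Y : Π x : M, TangentSpace I x) : Π x : M, TangentSpace I x :=
  fun y ↦ leviCivita I M Y y (X y)

theorem covDeriv_add {U : Set M} {X Y Z : Π x : M, TangentSpace I x}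
    (hY : SmoothFieldOn U Y) (hZ : SmoothFieldOn U Z) {y : M} (hy : y ∈ U) :
    covDeriv X (Y + Z) y = covDeriv X Y y + covDeriv X Z y := by
  simp [covDeriv,
    (leviCivita I M).isCovariantDerivativeOnUniv.add (hY.mdiffAt hy) (hZ.mdiffAt hy)]

theorem covDeriv_congr {U : Set M} (hU : IsOpen U) {X X' Y Y' : Π x : M, TangentSpace I x}
    (hY : SmoothFieldOn U Y) {y : M} (hy : y ∈ U) (hXX : X y = X' y) (h : ∀ z ∈ U, Y z = Y' z) :
    covDeriv X Y y = covDeriv X' Y' y := by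
  have := (leviCivita I M).isCovariantDerivativeOnUniv.congr_of_eventuallyEq (hY.mdiffAt hy)
    ((hY.congr hU fun z hz ↦ (h z hz).symm).mdiffAt hy) Filter.univ_mem
    (Filter.eventually_of_mem (hU.mem_nhds hy) h)
  simp only [covDeriv, this, hXX]

theorem covDeriv_sub {U : Set M} {X Y Z : Π x : M, TangentSpace I x}
    (hY : SmoothFieldOn U Y) (hZ : SmoothFieldOn U Z) {y : M} (hy : y ∈ U) :
    covDeriv X (Y - Z) y = covDeriv X Y y - covDeriv X Z y := by
  have := covDeriv_add (X := X) (hY.sub hZ) hZ hy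
  rw [sub_add_cancel] at this
  rw [this, add_sub_cancel_right]

theorem mvfderiv_inner {U : Set M} {X Y Z : Π x : M, TangentSpace I x}
    (hX : SmoothFieldOn U X) (hY : SmoothFieldOn U Y) (hZ : SmoothFieldOn U Z)
    {y : M} (hy : y ∈ U) :
    mvfderiv I (fun z ↦ inner ℝ (Y z) (Z z)) y (X y) =
      inner ℝ (covDeriv X Y y) (Z y) + inner ℝ (Y y) (covDeriv X Z y) :=
  leviCivita_metric (hX.mdiffAt hy) (hY.mdiffAt hy) (hZ.mdiffAt hy)

theorem covDeriv_sub_covDeriv {U : Set M} {X Y : Π x : M, TangentSpace I x}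
    (hX : SmoothFieldOn U X) (hY : SmoothFieldOn U Y) {y : M} (hy : y ∈ U) :
    covDeriv X Y y - covDeriv Y X y = mlieBracket I X Y y :=
  leviCivita_torsionFree (hX.mdiffAt hy) (hY.mdiffAt hy)

/-- In a smooth orthonormal frame the coefficients of ∇_X Y are half the Koszul expressions, which
are built from derivatives of inner products and from brackets. -/
theorem smoothFieldOn_covDeriv {U : Set M} {e : Fin 4 → Π x : M, TangentSpace I x}
    (he : IsOrthoFrameOn U e) {X Y : Π x : M, TangentSpace I x}
    (hX : SmoothFieldOn U X) (hY : SmoothFieldOn U Y) : SmoothFieldOn U (covDeriv X Y) := by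
  haveI : CompleteSpace E := FiniteDimensional.complete ℝ E
  have hd : ∀ {A B C : Π x : M, TangentSpace I x}, SmoothFieldOn U A → SmoothFieldOn U B →
      SmoothFieldOn U C →
      SmoothFunOn I U (fun y ↦ mvfderiv I (fun z ↦ inner ℝ (A z) (B z)) y (C y)) :=
    fun hA hB hC ↦ (hA.inner_bundle hB).deriv he.isOpen hC (he.smooth 0) he.inner_zero
  have hk : ∀ i, SmoothFunOn I U (fun y ↦ koszul I X Y (e i) y) := fun i ↦ by
    have hi := he.smooth i
    exact (((((hd hY hi hX).add (hd hX hi hY)).sub (hd hX hY hi)).add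
      ((hX.bracket hY).inner_bundle hi)).sub ((hX.bracket hi).inner_bundle hY)).sub
      ((hY.bracket hi).inner_bundle hX)
  refine SmoothFieldOn.congr he.isOpen (X := fun y ↦ ∑ i ∈ Finset.univ,
    ((fun z ↦ 1 / 2 * koszul I X Y (e i) z) • e i) y)
    (SmoothFieldOn.sum fun i ↦ (he.smooth i).smul ((SmoothFunOn.const (1 / 2)).mul (hk i)))
    fun y hy ↦ ?_
  rw [← he.sum_inner_smul hy (covDeriv X Y y)]
  refine Finset.sum_congr rfl fun i _ ↦ ?_
  rw [Pi.smul_apply', ← inner_leviCivitaFun (hX.mdiffAt hy) (hY.mdiffAt hy)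
    ((he.smooth i).mdiffAt hy)]
  rfl

/-- The vector field `∇_X ∇_Y Z - ∇_Y ∇_X Z - ∇_{[X, Y]} Z`. -/
def curvField (X Y Z : Π x : M, TangentSpace I x) : Π x : M, TangentSpace I x :=
  covDeriv X (covDeriv Y Z) - covDeriv Y (covDeriv X Z) - covDeriv (mlieBracket I X Y) Z

theorem smoothFieldOn_curvField {U : Set M} {e : Fin 4 → Π x : M, TangentSpace I x}
    (he : IsOrthoFrameOn U e) {X Y Z : Π x : M, TangentSpace I x}
    (hX : SmoothFieldOn U X) (hY : SmoothFieldOn U Y) (hZ : SmoothFieldOn U Z) :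
    SmoothFieldOn U (curvField X Y Z) := by
  haveI : CompleteSpace E := FiniteDimensional.complete ℝ E
  exact ((smoothFieldOn_covDeriv he hX (smoothFieldOn_covDeriv he hY hZ)).sub
    (smoothFieldOn_covDeriv he hY (smoothFieldOn_covDeriv he hX hZ))).sub
    (smoothFieldOn_covDeriv he (hX.bracket hY) hZ)

theorem curvField_swap (X Y Z : Π x : M, TangentSpace I x) (y : M) :
    curvField Y X Z y = -curvField X Y Z y := by
  have : mlieBracket I Y X y = -mlieBracket I X Y y := mlieBracket_swap_apply
  simp only [curvField, Pi.sub_apply]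
  rw [covDeriv.eq_def (mlieBracket I Y X), covDeriv.eq_def (mlieBracket I X Y), this, map_neg]
  abel

/-- Apply [X, Y] to the function g(Z, W) as a commutator of derivations. Metric compatibility used
twice produces mixed terms that are symmetric in X and Y and cancel. -/
theorem inner_curvField_skew {U : Set M} {e : Fin 4 → Π x : M, TangentSpace I x}
    (he : IsOrthoFrameOn U e) {X Y Z W : Π x : M, TangentSpace I x}
    (hX : SmoothFieldOn U X) (hY : SmoothFieldOn U Y) (hZ : SmoothFieldOn U Z)
    (hW : SmoothFieldOn U W) {y : M} (hy : y ∈ U) :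
    inner ℝ (curvField X Y Z y) (W y) = -inner ℝ (Z y) (curvField X Y W y) := by
  haveI : CompleteSpace E := FiniteDimensional.complete ℝ E
  have h := mvfderiv_mlieBracket he.isOpen (hZ.inner_bundle hW) hX hY (he.smooth 0) he.inner_zero hy
  have key : ∀ {A B : Π x : M, TangentSpace I x}, SmoothFieldOn U A → SmoothFieldOn U B →
      mvfderiv I (fun z ↦ mvfderiv I (fun w ↦ inner ℝ (Z w) (W w)) z (B z)) y (A y) =
        inner ℝ (covDeriv A (covDeriv B Z) y) (W y) + inner ℝ (covDeriv B Z y) (covDeriv A W y)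
        + (inner ℝ (covDeriv A Z y) (covDeriv B W y)
          + inner ℝ (Z y) (covDeriv A (covDeriv B W) y)) := by
    intro A B hA hB
    have hBZ := smoothFieldOn_covDeriv he hB hZ
    have hBW := smoothFieldOn_covDeriv he hB hW
    rw [mvfderiv_congr he.isOpen (fun z hz ↦ mvfderiv_inner hB hZ hW hz) hy,
      mvfderiv_fun_add ((hBZ.inner_bundle hW).mdiffAt hy) ((hZ.inner_bundle hBW).mdiffAt hy),
      add_apply, mvfderiv_inner hA hBZ hW hy, mvfderiv_inner hA hZ hBW hy]
  rw [key hX hY, key hY hX, mvfderiv_inner (hX.bracket hY) hZ hW hy] at h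
  simp only [curvField, Pi.sub_apply, inner_sub_left, inner_sub_right]
  linarith

/-- Torsion-freeness turns the second derivatives, grouped in pairs, into iterated brackets, and the
cyclic sum becomes the Jacobi identity. -/
theorem curvField_bianchi {U : Set M} {e : Fin 4 → Π x : M, TangentSpace I x}
    (he : IsOrthoFrameOn U e) {X Y Z : Π x : M, TangentSpace I x}
    (hX : SmoothFieldOn U X) (hY : SmoothFieldOn U Y) (hZ : SmoothFieldOn U Z)
    {y : M} (hy : y ∈ U) :
    curvField X Y Z y + curvField Y Z X y + curvField Z X Y y = 0 := by
  haveI : CompleteSpace E := FiniteDimensional.complete ℝ E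
  have key : ∀ {A B C : Π x : M, TangentSpace I x}, SmoothFieldOn U A → SmoothFieldOn U B →
      SmoothFieldOn U C → covDeriv A (covDeriv B C) y - covDeriv A (covDeriv C B) y
        - covDeriv (mlieBracket I B C) A y = mlieBracket I A (mlieBracket I B C) y := by
    intro A B C hA hB hC
    rw [← covDeriv_sub (smoothFieldOn_covDeriv he hB hC)
      (smoothFieldOn_covDeriv he hC hB) hy,
      covDeriv_congr he.isOpen ((smoothFieldOn_covDeriv he hB hC).sub
        (smoothFieldOn_covDeriv he hC hB)) hy rfl
        (fun z hz ↦ covDeriv_sub_covDeriv hB hC hz)]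
    exact covDeriv_sub_covDeriv hA (hB.bracket hC) hy
  have h1 := key hX hY hZ
  have h2 := key hY hZ hX
  have h3 := key hZ hX hY
  have hj := mlieBracket_jacobi hX hY hZ hy
  have s1 : mlieBracket I (mlieBracket I X Y) Z y = -mlieBracket I Z (mlieBracket I X Y) y :=
    mlieBracket_swap_apply
  have s2 : mlieBracket I Y (mlieBracket I X Z) y = -mlieBracket I Y (mlieBracket I Z X) y := by
    have : mlieBracket I X Z = (-1 : ℝ) • mlieBracket I Z X := by
      rw [mlieBracket_swap]; simp
    rw [this, mlieBracket_const_smul_right ((hZ.bracket hX).mdiffAt hy)]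
    simp
  simp only [curvField, Pi.sub_apply]
  linear_combination (norm := module) h1 + h2 + h3 + hj + s1 + s2

/-- The second Bianchi identity. -/
theorem curvField_bianchi_second {U : Set M} {e : Fin 4 → Π x : M, TangentSpace I x}
    (he : IsOrthoFrameOn U e) {X Y Z W : Π x : M, TangentSpace I x}
    (hX : SmoothFieldOn U X) (hY : SmoothFieldOn U Y) (hZ : SmoothFieldOn U Z)
    (hW : SmoothFieldOn U W) {y : M} (hy : y ∈ U) :
    (covDeriv X (curvField Y Z W) y - curvField Y Z (covDeriv X W) y
        + curvField X (mlieBracket I Y Z) W y)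
      + (covDeriv Y (curvField Z X W) y - curvField Z X (covDeriv Y W) y
        + curvField Y (mlieBracket I Z X) W y)
      + (covDeriv Z (curvField X Y W) y - curvField X Y (covDeriv Z W) y
        + curvField Z (mlieBracket I X Y) W y) = 0 := by
  haveI : CompleteSpace E := FiniteDimensional.complete ℝ E
  have c := fun {A B : Π x : M, TangentSpace I x} (hA : SmoothFieldOn U A)
    (hB : SmoothFieldOn U B) ↦ smoothFieldOn_covDeriv he hA hB
  have key : ∀ {A B C : Π x : M, TangentSpace I x}, SmoothFieldOn U A → SmoothFieldOn U B →
      SmoothFieldOn U C → covDeriv A (curvField B C W) y =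
        covDeriv A (covDeriv B (covDeriv C W)) y - covDeriv A (covDeriv C (covDeriv B W)) y
          - covDeriv A (covDeriv (mlieBracket I B C) W) y := by
    intro A B C hA hB hC
    rw [curvField, covDeriv_sub ((c hB (c hC hW)).sub (c hC (c hB hW)))
      (c (hB.bracket hC) hW) hy, covDeriv_sub (c hB (c hC hW)) (c hC (c hB hW)) hy]
  have s1 : mlieBracket I (mlieBracket I X Y) Z y = -mlieBracket I Z (mlieBracket I X Y) y :=
    mlieBracket_swap_apply
  have s2 : mlieBracket I Y (mlieBracket I X Z) y = -mlieBracket I Y (mlieBracket I Z X) y := by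
    have : mlieBracket I X Z = (-1 : ℝ) • mlieBracket I Z X := by
      rw [mlieBracket_swap]; simp
    rw [this, mlieBracket_const_smul_right ((hZ.bracket hX).mdiffAt hy)]
    simp
  -- The triple covariant derivatives cancel by the Jacobi identity for commutators of operators,
  -- and the second-order bracket terms cancel in pairs. What survives is the derivative of W along
  -- the Jacobi sum of brackets, which is zero.
  have hj : leviCivita I M W y (mlieBracket I X (mlieBracket I Y Z) y)
      + leviCivita I M W y (mlieBracket I Y (mlieBracket I Z X) y)
      + leviCivita I M W y (mlieBracket I Z (mlieBracket I X Y) y) = 0 := by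
    rw [← map_add, ← map_add, mlieBracket_jacobi hX hY hZ hy, s1, s2]
    simp
  rw [key hX hY hZ, key hY hZ hX, key hZ hX hY]
  simp only [curvField, Pi.sub_apply]
  change leviCivita I M W y _ + leviCivita I M W y _ + leviCivita I M W y _ = 0 at hj
  rw [covDeriv.eq_def (mlieBracket I X (mlieBracket I Y Z)) W,
    covDeriv.eq_def (mlieBracket I Y (mlieBracket I Z X)) W,
    covDeriv.eq_def (mlieBracket I Z (mlieBracket I X Y)) W]
  linear_combination (norm := module) -hj

end Connection

/-! ### Tensoriality and pointwise symmetries of the curvature. -/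

/-- The pair symmetry of algebraic curvature tensors. -/
theorem pair_symm_of_bianchi {α : Type*} (Q : α → α → α → α → ℝ)
    (h12 : ∀ a b c d, Q a b c d = -Q b a c d) (h34 : ∀ a b c d, Q a b c d = -Q a b d c)
    (hb : ∀ a b c d, Q a b c d + Q b c a d + Q c a b d = 0) (a b c d : α) :
    Q a b c d = Q c d a b := by
  linarith [hb a b c d, hb b c d a, hb c d a b, hb d a b c, h12 a b c d, h12 b c d a, h12 c d a b,
    h12 d a b c, h12 c a b d, h12 c a d b, h12 b d c a, h12 d b a c, h34 a b c d, h34 b c d a,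
    h34 c d a b, h34 d a b c, h34 c a b d, h34 b d c a, h34 d b a c, h34 b d a c, h34 a c d b,
    h12 a c d b, h12 b d a c, h34 b c a d, h34 d a c b, h34 a b d c, h34 c d b a]

section Curvature

variable {E : Type*} [NormedAddCommGroup E] [NormedSpace ℝ E]
  {H : Type*} [TopologicalSpace H] {I : ModelWithCorners ℝ E H}
  {M : Type*} [TopologicalSpace M] [ChartedSpace H M] [IsManifold I ∞ M]
  [RiemannianBundle (fun x : M ↦ TangentSpace I x)]
  [FiniteDimensional ℝ E]
  [IsContMDiffRiemannianBundle I ∞ E (fun x : M ↦ TangentSpace I x)]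

/-- The curvature depends only on the values of the vector fields at the point. -/
theorem inner_curvField_congr {U : Set M} {e : Fin 4 → Π x : M, TangentSpace I x}
    (he : IsOrthoFrameOn U e) {X Y Z W X' Y' Z' W' : Π x : M, TangentSpace I x}
    (hX : SmoothFieldOn U X) (hY : SmoothFieldOn U Y) (hZ : SmoothFieldOn U Z)
    (hW : SmoothFieldOn U W) (hX' : SmoothFieldOn U X') (hY' : SmoothFieldOn U Y')
    (hZ' : SmoothFieldOn U Z') (hW' : SmoothFieldOn U W') {y : M} (hy : y ∈ U)
    (eX : X y = X' y) (eY : Y y = Y' y) (eZ : Z y = Z' y) (eW : W y = W' y) :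
    inner ℝ (curvField X Y Z y) (W y) = (inner ℝ (curvField X' Y' Z' y) (W' y) : ℝ) := by
  let Q : {X : Π x : M, TangentSpace I x // SmoothFieldOn U X} →
    {X : Π x : M, TangentSpace I x // SmoothFieldOn U X} →
    {X : Π x : M, TangentSpace I x // SmoothFieldOn U X} →
    {X : Π x : M, TangentSpace I x // SmoothFieldOn U X} → ℝ :=
    fun a b c d ↦ inner ℝ (curvField a.1 b.1 c.1 y) (d.1 y)
  have h12 : ∀ a b c d, Q a b c d = -Q b a c d := fun a b c d ↦ by
    simp only [Q, curvField_swap b.1 a.1, inner_neg_left]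
  have h34 : ∀ a b c d, Q a b c d = -Q a b d c := fun a b c d ↦ by
    simp only [Q]
    rw [inner_curvField_skew he a.2 b.2 c.2 d.2 hy, real_inner_comm]
  have hb : ∀ a b c d, Q a b c d + Q b c a d + Q c a b d = 0 := fun a b c d ↦ by
    simp only [Q, ← inner_add_left]
    rw [curvField_bianchi he a.2 b.2 c.2 hy, inner_zero_left]
  have hp := pair_symm_of_bianchi Q h12 h34 hb
  -- `Q` is an expression in fields, but its last argument visibly enters through its value at y
  -- only. The symmetries carry every other slot to the last one, so no computation with function
  -- coefficients is needed.
  have c4 : ∀ a b c d d', d.1 y = d'.1 y → Q a b c d = Q a b c d' := fun a b c d d' h ↦ by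
    simp only [Q, h]
  have c3 : ∀ a b c c' d, c.1 y = c'.1 y → Q a b c d = Q a b c' d := fun a b c c' d h ↦ by
    rw [h34, c4 a b d c c' h, ← h34]
  have c2 : ∀ a b b' c d, b.1 y = b'.1 y → Q a b c d = Q a b' c d := fun a b b' c d h ↦ by
    rw [hp, c4 c d a b b' h, ← hp]
  have c1 : ∀ a a' b c d, a.1 y = a'.1 y → Q a b c d = Q a' b c d := fun a a' b c d h ↦ by
    rw [h12, c2 b a a' c d h, ← h12]
  change Q ⟨X, hX⟩ ⟨Y, hY⟩ ⟨Z, hZ⟩ ⟨W, hW⟩ = Q ⟨X', hX'⟩ ⟨Y', hY'⟩ ⟨Z', hZ'⟩ ⟨W', hW'⟩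
  rw [c1 _ ⟨X', hX'⟩ _ _ _ eX, c2 _ _ ⟨Y', hY'⟩ _ _ eY, c3 _ _ _ ⟨Z', hZ'⟩ _ eZ,
    c4 _ _ _ _ ⟨W', hW'⟩ eW]

theorem curvatureEndo_eq (x : M) (u v w : TangentSpace I x) :
    curvatureEndo I x u v w = curvField (extend E u) (extend E v) (extend E w) x := by
  simp only [curvatureEndo, curvField, covDeriv, Pi.sub_apply, extend_apply_self]
  rfl

/-- `riem` is defined through particular extensions of vectors, which are smooth only near the base
point. On the intersection of their domains with U they can be exchanged for any smooth fields with
the same values. -/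
theorem riem_eq {U : Set M} {e : Fin 4 → Π x : M, TangentSpace I x}
    (he : IsOrthoFrameOn U e) {X Y Z W : Π x : M, TangentSpace I x}
    (hX : SmoothFieldOn U X) (hY : SmoothFieldOn U Y) (hZ : SmoothFieldOn U Z)
    (hW : SmoothFieldOn U W) {y : M} (hy : y ∈ U) :
    riem I y (X y) (Y y) (Z y) (W y) = -inner ℝ (curvField X Y Z y) (W y) := by
  obtain ⟨V₁, o₁, m₁, h₁⟩ := exists_smoothFieldOn_extend y (X y)
  obtain ⟨V₂, o₂, m₂, h₂⟩ := exists_smoothFieldOn_extend y (Y y)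
  obtain ⟨V₃, o₃, m₃, h₃⟩ := exists_smoothFieldOn_extend y (Z y)
  have s : U ∩ (V₁ ∩ (V₂ ∩ V₃)) ⊆ U := fun z hz ↦ hz.1
  have he' := he.mono (he.isOpen.inter (o₁.inter (o₂.inter o₃))) s
  rw [riem, curvatureEndo_eq, inner_curvField_congr he' (h₁.mono fun z hz ↦ hz.2.1)
    (h₂.mono fun z hz ↦ hz.2.2.1) (h₃.mono fun z hz ↦ hz.2.2.2) (hW.mono s) (hX.mono s)
    (hY.mono s) (hZ.mono s) (hW.mono s) ⟨hy, m₁, m₂, m₃⟩ (extend_apply_self ..)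
    (extend_apply_self ..) (extend_apply_self ..) rfl]

/-- Constant-coefficient combinations of the frame suffice. This lets identities between fields be
read as identities between vectors. -/
theorem IsOrthoFrameOn.exists_field {U : Set M} {e : Fin 4 → Π x : M, TangentSpace I x}
    (he : IsOrthoFrameOn U e) {y : M} (hy : y ∈ U) (v : TangentSpace I y) :
    ∃ X : Π x : M, TangentSpace I x, SmoothFieldOn U X ∧ X y = v :=
  ⟨fun z ↦ ∑ i ∈ Finset.univ, ((fun _ ↦ inner ℝ v (e i y)) • e i) z,
    SmoothFieldOn.sum fun i ↦ (he.smooth i).smul (SmoothFunOn.const _), he.sum_inner_smul hy v⟩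

theorem riem_skew_left {U : Set M} {e : Fin 4 → Π x : M, TangentSpace I x}
    (he : IsOrthoFrameOn U e) {y : M} (hy : y ∈ U) (u v w z : TangentSpace I y) :
    riem I y u v w z = -riem I y v u w z := by
  obtain ⟨X, hX, rfl⟩ := he.exists_field hy u
  obtain ⟨Y, hY, rfl⟩ := he.exists_field hy v
  obtain ⟨Z, hZ, rfl⟩ := he.exists_field hy w
  obtain ⟨W, hW, rfl⟩ := he.exists_field hy z
  rw [riem_eq he hX hY hZ hW hy, riem_eq he hY hX hZ hW hy, curvField_swap, inner_neg_left]

theorem riem_skew_right {U : Set M} {e : Fin 4 → Π x : M, TangentSpace I x}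
    (he : IsOrthoFrameOn U e) {y : M} (hy : y ∈ U) (u v w z : TangentSpace I y) :
    riem I y u v w z = -riem I y u v z w := by
  obtain ⟨X, hX, rfl⟩ := he.exists_field hy u
  obtain ⟨Y, hY, rfl⟩ := he.exists_field hy v
  obtain ⟨Z, hZ, rfl⟩ := he.exists_field hy w
  obtain ⟨W, hW, rfl⟩ := he.exists_field hy z
  rw [riem_eq he hX hY hZ hW hy, riem_eq he hX hY hW hZ hy, inner_curvField_skew he hX hY hZ hW hy,
    real_inner_comm]

theorem riem_bianchi {U : Set M} {e : Fin 4 → Π x : M, TangentSpace I x}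
    (he : IsOrthoFrameOn U e) {y : M} (hy : y ∈ U) (u v w z : TangentSpace I y) :
    riem I y u v w z + riem I y v w u z + riem I y w u v z = 0 := by
  obtain ⟨X, hX, rfl⟩ := he.exists_field hy u
  obtain ⟨Y, hY, rfl⟩ := he.exists_field hy v
  obtain ⟨Z, hZ, rfl⟩ := he.exists_field hy w
  obtain ⟨W, hW, rfl⟩ := he.exists_field hy z
  rw [riem_eq he hX hY hZ hW hy, riem_eq he hY hZ hX hW hy, riem_eq he hZ hX hY hW hy,
    ← neg_add, ← neg_add, ← inner_add_left, ← inner_add_left, curvField_bianchi he hX hY hZ hy]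
  simp

theorem riem_pair {U : Set M} {e : Fin 4 → Π x : M, TangentSpace I x}
    (he : IsOrthoFrameOn U e) {y : M} (hy : y ∈ U) (u v w z : TangentSpace I y) :
    riem I y u v w z = riem I y w z u v :=
  pair_symm_of_bianchi (riem I y) (riem_skew_left he hy) (riem_skew_right he hy)
    (riem_bianchi he hy) u v w z

theorem riem_add₄ (y : M) (u v w z z' : TangentSpace I y) :
    riem I y u v w (z + z') = riem I y u v w z + riem I y u v w z' := by
  simp [riem, inner_add_right]; ring

theorem riem_smul₄ (y : M) (a : ℝ) (u v w z : TangentSpace I y) :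
    riem I y u v w (a • z) = a * riem I y u v w z := by
  simp [riem, inner_smul_right]

/-- The curvature tensor at a point, as a multilinear map. -/
def riemHom {U : Set M} {e : Fin 4 → Π x : M, TangentSpace I x}
    (he : IsOrthoFrameOn U e) {y : M} (hy : y ∈ U) :
    TangentSpace I y →ₗ[ℝ] TangentSpace I y →ₗ[ℝ] TangentSpace I y →ₗ[ℝ]
      TangentSpace I y →ₗ[ℝ] ℝ :=
  have s₃ := riem_skew_right he hy
  have p := riem_pair he hy
  have a₃ : ∀ u v w w' z, riem I y u v (w + w') z = riem I y u v w z + riem I y u v w' z :=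
    fun u v w w' z ↦ by rw [s₃, riem_add₄, s₃ _ _ w, s₃ _ _ w']; ring
  have m₃ : ∀ (a : ℝ) u v w z, riem I y u v (a • w) z = a * riem I y u v w z :=
    fun a u v w z ↦ by rw [s₃, riem_smul₄, s₃ _ _ w]; ring
  LinearMap.mk₂ ℝ
    (fun u v ↦ LinearMap.mk₂ ℝ (fun w z ↦ riem I y u v w z) (a₃ u v) (fun a ↦ m₃ a u v)
      (riem_add₄ y u v) (fun a w z ↦ riem_smul₄ y a u v w z))
    (fun u u' v ↦ by ext w z; simp [p _ v w z, a₃])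
    (fun a u v ↦ by ext w z; simp [p _ v w z, m₃])
    (fun u v v' ↦ by ext w z; simp [p u _ w z, riem_add₄])
    (fun a u v ↦ by ext w z; simp [p u _ w z, riem_smul₄])

theorem riemHom_apply {U : Set M} {e : Fin 4 → Π x : M, TangentSpace I x}
    (he : IsOrthoFrameOn U e) {y : M} (hy : y ∈ U) (u v w z : TangentSpace I y) :
    riemHom he hy u v w z = riem I y u v w z := rfl

end Curvature

/-! ### Existence of adapted frames. -/

section Frames

variable {E : Type*} [NormedAddCommGroup E] [NormedSpace ℝ E]
  {H : Type*} [TopologicalSpace H] {I : ModelWithCorners ℝ E H}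
  {M : Type*} [TopologicalSpace M] [ChartedSpace H M] [IsManifold I ∞ M]
  [RiemannianBundle (fun x : M ↦ TangentSpace I x)]
  [FiniteDimensional ℝ E]
  [IsContMDiffRiemannianBundle I ∞ E (fun x : M ↦ TangentSpace I x)]
  {J : Π x : M, TangentSpace I x →L[ℝ] TangentSpace I x}

/-- An orthonormal frame of the form `e₀, J e₀, e₂, J e₂`. -/
structure IsAdaptedFrameOn (J : Π x : M, TangentSpace I x →L[ℝ] TangentSpace I x) (U : Set M)
    (e : Fin 4 → Π x : M, TangentSpace I x) : Prop extends IsOrthoFrameOn U e where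
  apply_zero : ∀ y ∈ U, J y (e 0 y) = e 1 y
  apply_two : ∀ y ∈ U, J y (e 2 y) = e 3 y

theorem SmoothFieldOn.exists_normalize {U : Set M} (hU : IsOpen U) {X : Π x : M, TangentSpace I x}
    (hX : SmoothFieldOn U X) {x : M} (hx : x ∈ U) (h0 : X x ≠ 0) :
    ∃ V : Set M, IsOpen V ∧ x ∈ V ∧ V ⊆ U ∧ ∃ f : M → ℝ, SmoothFunOn I V f ∧
      ∀ y ∈ V, inner ℝ ((f • X) y) ((f • X) y) = (1 : ℝ) := by
  haveI : CompleteSpace E := FiniteDimensional.complete ℝ E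
  have hs := hX.inner_bundle hX
  have hc : ContinuousOn (fun y ↦ (inner ℝ (X y) (X y) : ℝ)) U :=
    fun y hy ↦ (hs y hy).continuousAt.continuousWithinAt
  have hpos : ∀ y, (inner ℝ (X y) (X y) : ℝ) ≠ 0 → (0 : ℝ) < inner ℝ (X y) (X y) :=
    fun y hy ↦ lt_of_le_of_ne real_inner_self_nonneg hy.symm
  refine ⟨U ∩ (fun y ↦ (inner ℝ (X y) (X y) : ℝ)) ⁻¹' {0}ᶜ,
    hc.isOpen_inter_preimage hU isOpen_compl_singleton, ⟨hx, by simpa using h0⟩,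
    Set.inter_subset_left, fun y ↦ (√(inner ℝ (X y) (X y)))⁻¹, fun y hy ↦ ?_, fun y hy ↦ ?_⟩
  · have h := hpos y hy.2
    have : ContDiffAt ℝ ∞ (fun t : ℝ ↦ (√t)⁻¹) (inner ℝ (X y) (X y)) :=
      (Real.contDiffAt_sqrt h.ne').inv (Real.sqrt_pos.2 h).ne'
    exact ContMDiffAt.comp (I' := 𝓘(ℝ, ℝ)) (g := fun t : ℝ ↦ (√t)⁻¹) y this.contMDiffAt (hs y hy.1)
  · have h := hpos y hy.2
    have h' := (Real.sqrt_pos.2 h).ne'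
    simp only [Pi.smul_apply', inner_smul_left, inner_smul_right, RCLike.conj_to_real]
    field_simp
    rw [Real.sq_sqrt h.le]

theorem IsAlmostHermitian.smoothFieldOn (hJ : IsAlmostHermitian J) {U : Set M}
    {X : Π x : M, TangentSpace I x} (hX : SmoothFieldOn U X) :
    SmoothFieldOn U (fun y ↦ J y (X y)) :=
  fun y hy ↦ ContMDiffAt.clm_bundle_apply (F₁ := E) (F₂ := E)
    (E₁ := fun x : M ↦ TangentSpace I x) (E₂ := fun x : M ↦ TangentSpace I x)
    (hJ.contMDiff y) (hX y hy)

theorem IsAlmostHermitian.inner_apply_left (hJ : IsAlmostHermitian J) (x : M)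
    (X Y : TangentSpace I x) : inner ℝ (J x X) Y = -(inner ℝ X (J x Y) : ℝ) := by
  rw [← hJ.inner_apply_apply x X (J x Y), hJ.apply_apply, inner_neg_right, neg_neg]

theorem IsAlmostHermitian.inner_apply_self (hJ : IsAlmostHermitian J) (x : M)
    (X : TangentSpace I x) : (inner ℝ (J x X) X : ℝ) = 0 := by
  have := hJ.inner_apply_left x X X
  rw [real_inner_comm (J x X) X] at this
  linarith

/-- This is Gram–Schmidt compatible with J: normalise a field a, set b = Ja, remove from a further
field its components along a and b, normalise the result to c, and add Jc. The span of a and b is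
J-invariant, so Jc is orthogonal to it as soon as c is. A starting vector outside this span exists
because 2 < 4. -/
theorem IsAlmostHermitian.exists_adaptedFrame (hJ : IsAlmostHermitian J) (h4 : finrank ℝ E = 4)
    (x : M) : ∃ (U : Set M) (e : Fin 4 → Π x : M, TangentSpace I x),
      x ∈ U ∧ IsAdaptedFrameOn J U e := by
  haveI : CompleteSpace E := FiniteDimensional.complete ℝ E
  have hfr : ∀ y : M, finrank ℝ (TangentSpace I y) = 4 := fun y ↦ h4
  haveI : Nontrivial (TangentSpace I x) := nontrivial_of_finrank_pos (R := ℝ) (by rw [hfr]; simp)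
  obtain ⟨v, hv⟩ := exists_ne (0 : TangentSpace I x)
  obtain ⟨U₀, o₀, m₀, h₀⟩ := exists_smoothFieldOn_extend x v
  obtain ⟨U₁, o₁, m₁, s₁, f, hf, hf1⟩ := h₀.exists_normalize o₀ m₀ (by simpa using hv)
  set a : Π x : M, TangentSpace I x := f • extend E v with ha_def
  have ha : SmoothFieldOn U₁ a := (h₀.mono s₁).smul hf
  set b : Π x : M, TangentSpace I x := fun y ↦ J y (a y) with hb_def
  have hb : SmoothFieldOn U₁ b := hJ.smoothFieldOn ha
  obtain ⟨w, hw⟩ : ∃ w : TangentSpace I x, w ∉ Submodule.span ℝ {a x, b x} := by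
    by_contra! h
    have h1 : Submodule.span ℝ {a x, b x} = ⊤ := Submodule.eq_top_iff'.2 h
    have h2 : finrank ℝ (Submodule.span ℝ ({a x, b x} : Set (TangentSpace I x))) ≤ 2 := by
      classical
      have := finrank_span_finset_le_card (R := ℝ) ({a x, b x} : Finset (TangentSpace I x))
      rw [Finset.coe_pair] at this
      exact this.trans Finset.card_le_two
    rw [h1, finrank_top, hfr] at h2
    omega
  obtain ⟨U₂, o₂, m₂, h₂⟩ := exists_smoothFieldOn_extend x w
  set W : Π x : M, TangentSpace I x := extend E w - (fun y ↦ inner ℝ (extend E w y) (a y)) • a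
    - (fun y ↦ inner ℝ (extend E w y) (b y)) • b with hW_def
  have hW : SmoothFieldOn (U₁ ∩ U₂) W := by
    have q1 := h₂.mono (Set.inter_subset_right (s := U₁))
    have q2 := ha.mono (Set.inter_subset_left (t := U₂))
    have q3 := hb.mono (Set.inter_subset_left (t := U₂))
    exact (q1.sub (q2.smul (q1.inner_bundle q2))).sub (q3.smul (q1.inner_bundle q3))
  have hWx : W x ≠ 0 := by
    intro h
    refine hw ?_
    simp only [hW_def, Pi.sub_apply, Pi.smul_apply', extend_apply_self] at h
    rw [sub_sub, sub_eq_zero] at h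
    rw [h]
    exact add_mem (Submodule.smul_mem _ _ (Submodule.subset_span (by simp)))
      (Submodule.smul_mem _ _ (Submodule.subset_span (by simp)))
  obtain ⟨U₃, o₃, m₃, s₃, g, hg, hg1⟩ := hW.exists_normalize (o₁.inter o₂) ⟨m₁, m₂⟩ hWx
  have hc : SmoothFieldOn U₃ (g • W) := (hW.mono s₃).smul hg
  have s₃₁ : U₃ ⊆ U₁ := fun y hy ↦ (s₃ hy).1
  refine ⟨U₃, ![a, b, g • W, fun y ↦ J y ((g • W) y)], m₃, ⟨o₃, fun i ↦ ?_, fun y hy ↦ ?_⟩,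
    fun y hy ↦ rfl, fun y hy ↦ rfl⟩
  · fin_cases i
    · exact ha.mono s₃₁
    · exact hb.mono s₃₁
    · exact hc
    · exact hJ.smoothFieldOn hc
  · have haa := hf1 y (s₃₁ hy)
    have hbb : (inner ℝ (b y) (b y) : ℝ) = 1 := by rw [← haa]; exact hJ.inner_apply_apply y _ _
    have hba : (inner ℝ (b y) (a y) : ℝ) = 0 := hJ.inner_apply_self y _
    have hab : (inner ℝ (a y) (b y) : ℝ) = 0 := by rw [real_inner_comm, hba]
    have hcc := hg1 y hy
    have hca : (inner ℝ ((g • W) y) (a y) : ℝ) = 0 := by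
      simp [-inner_self_eq_norm_sq_to_K, hW_def, inner_smul_left, inner_sub_left, haa, hba]
    have hcb : (inner ℝ ((g • W) y) (b y) : ℝ) = 0 := by
      simp [-inner_self_eq_norm_sq_to_K, hW_def, inner_smul_left, inner_sub_left, hbb, hab]
    have hda : (inner ℝ (J y ((g • W) y)) (a y) : ℝ) = 0 := by
      rw [hJ.inner_apply_left, neg_eq_zero]; exact hcb
    have hdb : (inner ℝ (J y ((g • W) y)) (b y) : ℝ) = 0 := by
      rw [← hca]; exact hJ.inner_apply_apply y _ _
    have hdc : (inner ℝ (J y ((g • W) y)) ((g • W) y) : ℝ) = 0 := hJ.inner_apply_self y _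
    have hdd : (inner ℝ (J y ((g • W) y)) (J y ((g • W) y)) : ℝ) = 1 := by
      rw [← hcc]; exact hJ.inner_apply_apply y _ _
    generalize hcW : (g • W) y = c at *
    have ho : Orthonormal ℝ (fun i ↦ (![a y, b y, c, J y c] : Fin 4 → TangentSpace I y) i) := by
      rw [orthonormal_iff_ite]
      intro i j
      fin_cases i <;> fin_cases j <;>
        simp [-inner_self_eq_norm_sq_to_K, haa, hbb, hba, hab, hcc,
          hca, hcb, hda, hdb, hdc, hdd, real_inner_comm c (a y), real_inner_comm c (b y),
          real_inner_comm (J y c) (a y), real_inner_comm (J y c) (b y), real_inner_comm (J y c) c]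
    obtain ⟨β, hβ⟩ := Orthonormal.exists_orthonormalBasis_extension_of_card_eq (ι := Fin 4)
      (by rw [hfr]; simp) (s := Set.univ) (v := ![a y, b y, c, J y c])
      (by exact ho.comp _ Subtype.val_injective)
    refine ⟨β, fun i ↦ ?_⟩
    rw [hβ i (Set.mem_univ i)]
    fin_cases i
    · rfl
    · rfl
    · exact hcW.symm
    · exact congrArg (J y) hcW.symm

end Frames

/-! ### Connection coefficients, the structure equation and the second Bianchi identity in a frame.
-/

section Components

variable {E : Type*} [NormedAddCommGroup E] [NormedSpace ℝ E]
  {H : Type*} [TopologicalSpace H] {I : ModelWithCorners ℝ E H}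
  {M : Type*} [TopologicalSpace M] [ChartedSpace H M] [IsManifold I ∞ M]
  [RiemannianBundle (fun x : M ↦ TangentSpace I x)]
  [FiniteDimensional ℝ E]
  [IsContMDiffRiemannianBundle I ∞ E (fun x : M ↦ TangentSpace I x)]

/-- The connection coefficient `g(∇_{e_i} e_j, e_k)`. -/
def christoffel (e : Fin 4 → Π x : M, TangentSpace I x) (i j k : Fin 4) (y : M) : ℝ :=
  inner ℝ (covDeriv (e i) (e j) y) (e k y)

/-- The component `R_{ijkl}` of the curvature tensor in a frame. -/
def riemComp (e : Fin 4 → Π x : M, TangentSpace I x) (i j k l : Fin 4) (y : M) : ℝ :=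
  riem I y (e i y) (e j y) (e k y) (e l y)

/-- The derivative of a function along a frame field. -/
def frameDeriv (e : Fin 4 → Π x : M, TangentSpace I x) (i : Fin 4) (f : M → ℝ) (y : M) : ℝ :=
  mvfderiv I f y (e i y)

variable {U : Set M} {e : Fin 4 → Π x : M, TangentSpace I x} {y : M}

theorem frameDeriv_congr (hU : IsOpen U) {f g : M → ℝ} (h : ∀ z ∈ U, f z = g z)
    (hy : y ∈ U) (i : Fin 4) : frameDeriv e i f y = frameDeriv e i g y := by
  haveI : CompleteSpace E := FiniteDimensional.complete ℝ E
  rw [frameDeriv, frameDeriv, mvfderiv_congr hU h hy]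

theorem frameDeriv_add {f g : M → ℝ} (hf : SmoothFunOn I U f) (hg : SmoothFunOn I U g)
    (hy : y ∈ U) (i : Fin 4) :
    frameDeriv e i (fun z ↦ f z + g z) y = frameDeriv e i f y + frameDeriv e i g y := by
  simp [frameDeriv, mvfderiv_fun_add (hf.mdiffAt hy) (hg.mdiffAt hy)]

theorem frameDeriv_neg (f : M → ℝ) (i : Fin 4) :
    frameDeriv e i (fun z ↦ -f z) y = -frameDeriv e i f y := by
  have : (fun z ↦ -f z) = -f := rfl
  rw [frameDeriv, this, mvfderiv_neg]
  rfl

namespace IsOrthoFrameOn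

theorem smooth_christoffel (he : IsOrthoFrameOn U e) (i j k : Fin 4) :
    SmoothFunOn I U (christoffel e i j k) := by
  haveI : CompleteSpace E := FiniteDimensional.complete ℝ E
  exact (smoothFieldOn_covDeriv he (he.smooth i) (he.smooth j)).inner_bundle (he.smooth k)

theorem smooth_riemComp (he : IsOrthoFrameOn U e) (i j k l : Fin 4) :
    SmoothFunOn I U (riemComp e i j k l) := by
  haveI : CompleteSpace E := FiniteDimensional.complete ℝ E
  refine SmoothFunOn.congr he.isOpen ((SmoothFunOn.const (-1)).mul
    ((smoothFieldOn_curvField he (he.smooth i) (he.smooth j) (he.smooth k)).inner_bundle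
      (he.smooth l))) fun y hy ↦ ?_
  rw [riemComp, riem_eq he (he.smooth i) (he.smooth j) (he.smooth k) (he.smooth l) hy]
  ring

theorem covDeriv_eq (he : IsOrthoFrameOn U e) (hy : y ∈ U) (i j : Fin 4) :
    covDeriv (e i) (e j) y = ∑ k, christoffel e i j k y • e k y :=
  (he.sum_inner_smul hy _).symm

theorem mlieBracket_eq (he : IsOrthoFrameOn U e) (hy : y ∈ U) (i j : Fin 4) :
    mlieBracket I (e i) (e j) y =
      ∑ k, (christoffel e i j k y - christoffel e j i k y) • e k y := by
  rw [← covDeriv_sub_covDeriv (he.smooth i) (he.smooth j) hy, he.covDeriv_eq hy, he.covDeriv_eq hy,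
    ← Finset.sum_sub_distrib]
  simp only [sub_smul]

theorem christoffel_skew (he : IsOrthoFrameOn U e) (hy : y ∈ U) (i j k : Fin 4) :
    christoffel e i j k y = -christoffel e i k j y := by
  haveI : CompleteSpace E := FiniteDimensional.complete ℝ E
  have h := mvfderiv_inner (he.smooth i) (he.smooth j) (he.smooth k) hy
  rw [mvfderiv_congr (g := fun _ ↦ if j = k then (1 : ℝ) else 0) he.isOpen
    (fun z hz ↦ he.inner_eq hz j k) hy, mvfderiv_const, real_inner_comm _ (e j y)] at h
  rw [christoffel, christoffel]
  linarith [show (0 : TangentSpace I y →L[ℝ] ℝ) (e i y) = 0 from rfl]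

/-- Cartan's second structure equation: metric compatibility gives g(∇_i∇_j e_k, e_l) = e_i(Γ_jkl) −
g(∇_j e_k, ∇_i e_l), and the bracket is expanded by torsion-freeness. It serves the formula for
|∇J|². -/
theorem riemComp_eq (he : IsOrthoFrameOn U e) (hy : y ∈ U) (i j k l : Fin 4) :
    riemComp e i j k l y =
      -(frameDeriv e i (christoffel e j k l) y - frameDeriv e j (christoffel e i k l) y
        - ∑ m, christoffel e j k m y * christoffel e i l m y
        + ∑ m, christoffel e i k m y * christoffel e j l m y
        - ∑ m, (christoffel e i j m y - christoffel e j i m y) * christoffel e m k l y) := by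
  have key : ∀ i j, inner ℝ (covDeriv (e i) (covDeriv (e j) (e k)) y) (e l y) =
      frameDeriv e i (christoffel e j k l) y
        - ∑ m, christoffel e j k m y * christoffel e i l m y := fun i j ↦ by
    have h := mvfderiv_inner (he.smooth i) (smoothFieldOn_covDeriv he (he.smooth j) (he.smooth k))
      (he.smooth l) hy
    have h2 : (inner ℝ (covDeriv (e j) (e k) y) (covDeriv (e i) (e l) y) : ℝ) =
        ∑ m, christoffel e j k m y * christoffel e i l m y := by
      rw [he.covDeriv_eq hy i l, inner_sum]
      refine Finset.sum_congr rfl fun m _ ↦ ?_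
      rw [inner_smul_right, christoffel, christoffel, mul_comm]
    rw [← h2]
    change frameDeriv e i (christoffel e j k l) y = _ at h
    linarith
  have hb : inner ℝ (covDeriv (mlieBracket I (e i) (e j)) (e k) y) (e l y) =
      ∑ m, (christoffel e i j m y - christoffel e j i m y) * christoffel e m k l y := by
    rw [covDeriv, he.mlieBracket_eq hy, map_sum, sum_inner]
    refine Finset.sum_congr rfl fun m _ ↦ ?_
    rw [map_smul, inner_smul_left]
    rfl
  rw [riemComp, riem_eq he (he.smooth i) (he.smooth j) (he.smooth k) (he.smooth l) hy]
  simp only [curvField, Pi.sub_apply, inner_sub_left]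
  rw [key i j, key j i, hb]
  ring

/-- The second Bianchi identity in an orthonormal frame. -/
theorem bianchi_second (he : IsOrthoFrameOn U e) (hy : y ∈ U) (i j k m l : Fin 4) :
    (frameDeriv e i (riemComp e j k m l) y
        - ∑ p, christoffel e i l p y * riemComp e j k m p y
        - ∑ p, christoffel e i m p y * riemComp e j k p l y
        + ∑ p, (christoffel e j k p y - christoffel e k j p y) * riemComp e i p m l y)
      + (frameDeriv e j (riemComp e k i m l) y
        - ∑ p, christoffel e j l p y * riemComp e k i m p y
        - ∑ p, christoffel e j m p y * riemComp e k i p l y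
        + ∑ p, (christoffel e k i p y - christoffel e i k p y) * riemComp e j p m l y)
      + (frameDeriv e k (riemComp e i j m l) y
        - ∑ p, christoffel e k l p y * riemComp e i j m p y
        - ∑ p, christoffel e k m p y * riemComp e i j p l y
        + ∑ p, (christoffel e i j p y - christoffel e j i p y) * riemComp e k p m l y) = 0 := by
  haveI : CompleteSpace E := FiniteDimensional.complete ℝ E
  have key : ∀ i j k, inner ℝ (covDeriv (e i) (curvField (e j) (e k) (e m)) y
      - curvField (e j) (e k) (covDeriv (e i) (e m)) y
      + curvField (e i) (mlieBracket I (e j) (e k)) (e m) y) (e l y) =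
      -(frameDeriv e i (riemComp e j k m l) y
        - ∑ p, christoffel e i l p y * riemComp e j k m p y
        - ∑ p, christoffel e i m p y * riemComp e j k p l y
        + ∑ p, (christoffel e j k p y - christoffel e k j p y) * riemComp e i p m l y) := by
    intro i j k
    have si := he.smooth i
    have sj := he.smooth j
    have sk := he.smooth k
    have sm := he.smooth m
    have sl := he.smooth l
    have h1 := mvfderiv_inner si (smoothFieldOn_curvField he sj sk sm) sl hy
    have h1' : mvfderiv I (fun z ↦ inner ℝ (curvField (e j) (e k) (e m) z) (e l z)) y (e i y) =
        -frameDeriv e i (riemComp e j k m l) y := by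
      rw [← frameDeriv_neg]
      exact frameDeriv_congr he.isOpen (fun z hz ↦ by
        rw [riemComp, riem_eq he sj sk sm sl hz, neg_neg]) hy i
    -- These are the three corrections to e_i(R_jkml): the derivative falling on e_l, the derivative
    -- falling on e_m, and the bracket of e_j and e_k, which accounts for the derivatives of the
    -- first pair. The overall sign is the one in the definition of `riem`.
    have h2 := riem_eq he sj sk sm (smoothFieldOn_covDeriv he si sl) hy
    have h3 := riem_eq he sj sk (smoothFieldOn_covDeriv he si sm) sl hy
    have h4 := riem_eq he si (sj.bracket sk) sm sl hy
    rw [he.covDeriv_eq hy i l, ← riemHom_apply he hy, map_sum] at h2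
    rw [he.covDeriv_eq hy i m, ← riemHom_apply he hy, map_sum, LinearMap.sum_apply] at h3
    rw [he.mlieBracket_eq hy j k, ← riemHom_apply he hy, map_sum, LinearMap.sum_apply,
      LinearMap.sum_apply] at h4
    simp only [map_smul, LinearMap.smul_apply, riemHom_apply, smul_eq_mul] at h2 h3 h4
    rw [← he.covDeriv_eq hy i l] at h2
    simp only [inner_add_left, inner_sub_left, riemComp] at h1 h1' ⊢
    rw [h2, h3, h4]
    linarith
  have h := congrArg (fun v ↦ (inner ℝ v (e l y) : ℝ))
    (curvField_bianchi_second he (he.smooth i) (he.smooth j) (he.smooth k) (he.smooth m) hy)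
  simp only [inner_zero_left] at h
  rw [inner_add_left, inner_add_left, key, key, key] at h
  linarith

theorem riemComp_skew_left (he : IsOrthoFrameOn U e) (hy : y ∈ U) (i j k l : Fin 4) :
    riemComp e i j k l y = -riemComp e j i k l y :=
  riem_skew_left he hy _ _ _ _

theorem riemComp_skew_right (he : IsOrthoFrameOn U e) (hy : y ∈ U) (i j k l : Fin 4) :
    riemComp e i j k l y = -riemComp e i j l k y :=
  riem_skew_right he hy _ _ _ _

theorem riemComp_pair (he : IsOrthoFrameOn U e) (hy : y ∈ U) (i j k l : Fin 4) :
    riemComp e i j k l y = riemComp e k l i j y :=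
  riem_pair he hy _ _ _ _

theorem riemComp_bianchi (he : IsOrthoFrameOn U e) (hy : y ∈ U) (i j k l : Fin 4) :
    riemComp e i j k l y + riemComp e j k i l y + riemComp e k i j l y = 0 :=
  riem_bianchi he hy _ _ _ _

end IsOrthoFrameOn

end Components

/-! ### Independence of traces from the orthonormal basis. -/

section Traces

variable {V : Type*} [NormedAddCommGroup V] [InnerProductSpace ℝ V]
  {ι κ : Type*} [Fintype ι] [Fintype κ]

/-- The function `B` of two vectors is bilinear. -/
structure IsBilin (B : V → V → ℝ) : Prop where
  add_left : ∀ u u' v, B (u + u') v = B u v + B u' v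
  smul_left : ∀ (a : ℝ) u v, B (a • u) v = a * B u v
  add_right : ∀ u v v', B u (v + v') = B u v + B u v'
  smul_right : ∀ (a : ℝ) u v, B u (a • v) = a * B u v

/-- Traces do not depend on the orthonormal basis. -/
theorem IsBilin.sum_basis {B : V → V → ℝ} (hB : IsBilin B) (b : OrthonormalBasis ι ℝ V)
    (c : OrthonormalBasis κ ℝ V) : ∑ i, B (b i) (b i) = ∑ j, B (c j) (c j) := by
  let L : V →ₗ[ℝ] V →ₗ[ℝ] ℝ := LinearMap.mk₂ ℝ B hB.add_left (fun a u v ↦ hB.smul_left a u v)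
    hB.add_right (fun a u v ↦ hB.smul_right a u v)
  have h1 : ∀ i, L (b i) (b i) = ∑ j, inner ℝ (c j) (b i) * L (c j) (b i) := fun i ↦ by
    have h := congrArg (fun v ↦ L v (b i)) (c.sum_repr' (b i))
    simp only [map_sum, LinearMap.sum_apply, map_smul, LinearMap.smul_apply, smul_eq_mul] at h
    exact h.symm
  have h2 : ∀ j, L (c j) (c j) = ∑ i, inner ℝ (c j) (b i) * L (c j) (b i) := fun j ↦ by
    conv_lhs => rw [← b.sum_repr' (c j)]
    rw [map_sum]
    simp only [b.sum_repr' (c j), map_smul, smul_eq_mul, real_inner_comm]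
  change ∑ i, L (b i) (b i) = ∑ j, L (c j) (c j)
  simp only [h1, h2]
  exact Finset.sum_comm

theorem IsBilin.sum_sum_basis {B C : V → V → ℝ} (hB : IsBilin B) (hC : IsBilin C)
    (b : OrthonormalBasis ι ℝ V) (c : OrthonormalBasis κ ℝ V) :
    ∑ i, ∑ j, B (b i) (b j) * C (b i) (b j) = ∑ i, ∑ j, B (c i) (c j) * C (c i) (c j) := by
  have h1 : ∀ u, ∑ j, B u (b j) * C u (b j) = ∑ j, B u (c j) * C u (c j) := fun u ↦
    IsBilin.sum_basis (B := fun v w ↦ B u v * C u w)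
      ⟨fun _ _ _ ↦ by rw [hB.add_right]; ring, fun _ _ _ ↦ by rw [hB.smul_right]; ring,
        fun _ _ _ ↦ by rw [hC.add_right]; ring, fun _ _ _ ↦ by rw [hC.smul_right]; ring⟩ b c
  simp only [h1]
  exact IsBilin.sum_basis (B := fun v w ↦ ∑ j, B v (c j) * C w (c j))
      ⟨fun _ _ _ ↦ by simp only [hB.add_left, add_mul, Finset.sum_add_distrib],
        fun _ _ _ ↦ by simp only [hB.smul_left, mul_assoc, Finset.mul_sum],
        fun _ _ _ ↦ by simp only [hC.add_left, mul_add, Finset.sum_add_distrib],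
        fun _ _ _ ↦ by simp only [hC.smul_left, mul_left_comm, Finset.mul_sum]⟩ b c

theorem IsBilin.add {B C : V → V → ℝ} (hB : IsBilin B) (hC : IsBilin C) :
    IsBilin (fun u v ↦ B u v + C u v) :=
  ⟨fun _ _ _ ↦ by rw [hB.add_left, hC.add_left]; ring,
    fun _ _ _ ↦ by rw [hB.smul_left, hC.smul_left]; ring,
    fun _ _ _ ↦ by rw [hB.add_right, hC.add_right]; ring,
    fun _ _ _ ↦ by rw [hB.smul_right, hC.smul_right]; ring⟩

theorem IsBilin.const_mul {B : V → V → ℝ} (hB : IsBilin B) (a : ℝ) :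
    IsBilin (fun u v ↦ a * B u v) :=
  ⟨fun _ _ _ ↦ by rw [hB.add_left]; ring, fun _ _ _ ↦ by rw [hB.smul_left]; ring,
    fun _ _ _ ↦ by rw [hB.add_right]; ring, fun _ _ _ ↦ by rw [hB.smul_right]; ring⟩

theorem IsBilin.sub {B C : V → V → ℝ} (hB : IsBilin B) (hC : IsBilin C) :
    IsBilin (fun u v ↦ B u v - C u v) := by
  simpa [sub_eq_add_neg] using hB.add (hC.const_mul (-1))

theorem IsBilin.sum {s : Finset ι} {B : ι → V → V → ℝ} (hB : ∀ i, IsBilin (B i)) :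
    IsBilin (fun u v ↦ ∑ i ∈ s, B i u v) :=
  ⟨fun _ _ _ ↦ by simp only [(hB _).add_left, Finset.sum_add_distrib],
    fun _ _ _ ↦ by simp only [(hB _).smul_left, Finset.mul_sum],
    fun _ _ _ ↦ by simp only [(hB _).add_right, Finset.sum_add_distrib],
    fun _ _ _ ↦ by simp only [(hB _).smul_right, Finset.mul_sum]⟩

theorem isBilin_inner : IsBilin (fun u v : V ↦ (inner ℝ u v : ℝ)) :=
  ⟨fun _ _ _ ↦ inner_add_left .., fun _ _ _ ↦ by simp [inner_smul_left],
    fun _ _ _ ↦ inner_add_right .., fun _ _ _ ↦ by simp [inner_smul_right]⟩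

theorem IsBilin.neg_left {B : V → V → ℝ} (hB : IsBilin B) (u v : V) : B (-u) v = -B u v := by
  rw [← neg_one_smul ℝ u, hB.smul_left, neg_one_mul]

theorem IsBilin.neg_right {B : V → V → ℝ} (hB : IsBilin B) (u v : V) : B u (-v) = -B u v := by
  rw [← neg_one_smul ℝ v, hB.smul_right, neg_one_mul]

end Traces

/-! ### The scalar invariants s, s* and κ in an adapted frame. -/

section PointwiseTraces

variable {E : Type*} [NormedAddCommGroup E] [NormedSpace ℝ E]
  {H : Type*} [TopologicalSpace H] {I : ModelWithCorners ℝ E H}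
  {M : Type*} [TopologicalSpace M] [ChartedSpace H M] [IsManifold I ∞ M]
  [RiemannianBundle (fun x : M ↦ TangentSpace I x)]
  [FiniteDimensional ℝ E]
  [IsContMDiffRiemannianBundle I ∞ E (fun x : M ↦ TangentSpace I x)]
  {J : Π x : M, TangentSpace I x →L[ℝ] TangentSpace I x}
  {U : Set M} {e : Fin 4 → Π x : M, TangentSpace I x} {y : M}

theorem isBilin_kulkarniNomizu_left {h k : TangentSpace I y → TangentSpace I y → ℝ}
    (hh : IsBilin h) (hk : IsBilin k) (Z W : TangentSpace I y) :
    IsBilin (fun X Y ↦ kulkarniNomizu I h k X Y Z W) := by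
  constructor <;> intros <;>
    simp only [kulkarniNomizu, hh.add_left, hk.add_left, hh.smul_left, hk.smul_left] <;> ring

theorem isBilin_kulkarniNomizu_right {h k : TangentSpace I y → TangentSpace I y → ℝ}
    (hh : IsBilin h) (hk : IsBilin k) (X Y : TangentSpace I y) :
    IsBilin (fun Z W ↦ kulkarniNomizu I h k X Y Z W) := by
  constructor <;> intros <;>
    simp only [kulkarniNomizu, hh.add_right, hk.add_right, hh.smul_right, hk.smul_right] <;> ring

theorem isBilin_fundForm : IsBilin (fundForm J y) :=
  ⟨fun _ _ _ ↦ by simp [fundForm, inner_add_left],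
    fun _ _ _ ↦ by simp [fundForm, inner_smul_left],
    fun _ _ _ ↦ by simp [fundForm, inner_add_right],
    fun _ _ _ ↦ by simp [fundForm, inner_smul_right]⟩

theorem isBilin_volForm_left (Z W : TangentSpace I y) :
    IsBilin (fun X Y ↦ volForm J y X Y Z W) := by
  have h := isBilin_fundForm (J := J) (y := y)
  constructor <;> intros <;>
    simp only [volForm, h.add_left, h.smul_left, h.add_right, h.smul_right] <;> ring

theorem isBilin_volForm_right (X Y : TangentSpace I y) :
    IsBilin (fun Z W ↦ volForm J y X Y Z W) := by
  have h := isBilin_fundForm (J := J) (y := y)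
  constructor <;> intros <;>
    simp only [volForm, h.add_left, h.smul_left, h.add_right, h.smul_right] <;> ring

theorem isBilin_curvOp {T : TangentSpace I y → TangentSpace I y → TangentSpace I y →
    TangentSpace I y → ℝ} (hT : ∀ X Y, IsBilin (T X Y))
    (φ : TangentSpace I y → TangentSpace I y → ℝ) : IsBilin (curvOp I y T φ) :=
  IsBilin.const_mul (IsBilin.sum fun _ ↦ IsBilin.sum fun _ ↦ (hT _ _).const_mul _) _

theorem isBilin_selfDualPart {φ : TangentSpace I y → TangentSpace I y → ℝ} (hφ : IsBilin φ) :
    IsBilin (selfDualPart J y φ) :=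
  (hφ.add (IsBilin.const_mul (IsBilin.sum fun _ ↦ IsBilin.sum fun _ ↦
    (isBilin_volForm_right _ _).const_mul _) _)).const_mul _

namespace IsOrthoFrameOn

/-- The invariants are defined with a basis chosen separately at each point, with no smoothness in
the point; this and `sum_frame` move them to the smooth frame. -/
theorem sum_sum_frame (he : IsOrthoFrameOn U e) (hy : y ∈ U)
    {B C : TangentSpace I y → TangentSpace I y → ℝ} (hB : IsBilin B) (hC : IsBilin C) :
    ∑ i, ∑ j, B (frame I y i) (frame I y j) * C (frame I y i) (frame I y j) =
      ∑ i, ∑ j, B (e i y) (e j y) * C (e i y) (e j y) := by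
  obtain ⟨b, hb⟩ := he.basis y hy
  simp only [← hb]
  exact hB.sum_sum_basis hC _ b

theorem sum_frame (he : IsOrthoFrameOn U e) (hy : y ∈ U)
    {B : TangentSpace I y → TangentSpace I y → ℝ} (hB : IsBilin B) :
    ∑ i, B (frame I y i) (frame I y i) = ∑ i, B (e i y) (e i y) := by
  obtain ⟨b, hb⟩ := he.basis y hy
  simp only [← hb]
  exact hB.sum_basis _ b

theorem isBilin_riem_left (he : IsOrthoFrameOn U e) (hy : y ∈ U) (Z W : TangentSpace I y) :
    IsBilin (fun X Y ↦ riem I y X Y Z W) := by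
  constructor <;> intros <;> simp [← riemHom_apply he hy]

theorem isBilin_riem_right (he : IsOrthoFrameOn U e) (hy : y ∈ U) (X Y : TangentSpace I y) :
    IsBilin (fun Z W ↦ riem I y X Y Z W) := by
  constructor <;> intros <;> simp [← riemHom_apply he hy]

theorem isBilin_riem_odd (he : IsOrthoFrameOn U e) (hy : y ∈ U) (Y W : TangentSpace I y) :
    IsBilin (fun X Z ↦ riem I y X Y Z W) := by
  constructor <;> intros <;> simp [← riemHom_apply he hy]

theorem isBilin_riem_even (he : IsOrthoFrameOn U e) (hy : y ∈ U) (X Z : TangentSpace I y) :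
    IsBilin (fun Y W ↦ riem I y X Y Z W) := by
  constructor <;> intros <;> simp [← riemHom_apply he hy]

theorem isBilin_ric (he : IsOrthoFrameOn U e) (hy : y ∈ U) : IsBilin (ric I y) :=
  IsBilin.sum fun _ ↦ he.isBilin_riem_even hy _ _

theorem isBilin_ricZero (he : IsOrthoFrameOn U e) (hy : y ∈ U) : IsBilin (ricZero I y) :=
  (he.isBilin_ric hy).sub (isBilin_inner.const_mul _)

theorem isBilin_weyl_left (he : IsOrthoFrameOn U e) (hy : y ∈ U) (Z W : TangentSpace I y) :
    IsBilin (fun X Y ↦ weyl I y X Y Z W) :=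
  ((he.isBilin_riem_left hy Z W).sub
    ((isBilin_kulkarniNomizu_left isBilin_inner isBilin_inner Z W).const_mul _)).sub
    ((isBilin_kulkarniNomizu_left (he.isBilin_ricZero hy) isBilin_inner Z W).const_mul _)

theorem isBilin_weyl_right (he : IsOrthoFrameOn U e) (hy : y ∈ U) (X Y : TangentSpace I y) :
    IsBilin (fun Z W ↦ weyl I y X Y Z W) :=
  ((he.isBilin_riem_right hy X Y).sub
    ((isBilin_kulkarniNomizu_right isBilin_inner isBilin_inner X Y).const_mul _)).sub
    ((isBilin_kulkarniNomizu_right (he.isBilin_ricZero hy) isBilin_inner X Y).const_mul _)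

theorem ric_eq (he : IsOrthoFrameOn U e) (hy : y ∈ U) (X Y : TangentSpace I y) :
    ric I y X Y = ∑ i, riem I y (e i y) X (e i y) Y :=
  he.sum_frame hy (he.isBilin_riem_odd hy X Y)

theorem scal_eq (he : IsOrthoFrameOn U e) (hy : y ∈ U) :
    scal I y = ∑ j, ∑ i, riemComp e i j i j y := by
  rw [scal, he.sum_frame hy (he.isBilin_ric hy)]
  simp only [he.ric_eq hy]
  rfl

theorem curvOp_eq (he : IsOrthoFrameOn U e) (hy : y ∈ U)
    {T : TangentSpace I y → TangentSpace I y → TangentSpace I y → TangentSpace I y → ℝ}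
    (hT : ∀ Z W, IsBilin (fun X Y ↦ T X Y Z W)) {φ : TangentSpace I y → TangentSpace I y → ℝ}
    (hφ : IsBilin φ) (X Y : TangentSpace I y) :
    curvOp I y T φ X Y =
      (1 / 2) * ∑ i, ∑ j, φ (e i y) (e j y) * T (e i y) (e j y) X Y := by
  rw [curvOp, he.sum_sum_frame hy hφ (hT X Y)]

theorem hodgeStar_eq (he : IsOrthoFrameOn U e) (hy : y ∈ U)
    {φ : TangentSpace I y → TangentSpace I y → ℝ}
    (hφ : IsBilin φ) (X Y : TangentSpace I y) :
    hodgeStar J y φ X Y =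
      (1 / 2) * ∑ i, ∑ j, φ (e i y) (e j y) * volForm J y (e i y) (e j y) X Y :=
  he.curvOp_eq hy isBilin_volForm_left hφ X Y

theorem formInner_eq (he : IsOrthoFrameOn U e) (hy : y ∈ U)
    {φ ψ : TangentSpace I y → TangentSpace I y → ℝ} (hφ : IsBilin φ) (hψ : IsBilin ψ) :
    formInner I y φ ψ = (1 / 2) * ∑ i, ∑ j, φ (e i y) (e j y) * ψ (e i y) (e j y) := by
  rw [formInner, he.sum_sum_frame hy hφ hψ]

end IsOrthoFrameOn

/-- The components of the fundamental form in an adapted frame. -/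
def stdForm : Matrix (Fin 4) (Fin 4) ℝ :=
  !![0, 1, 0, 0; -1, 0, 0, 0; 0, 0, 0, 1; 0, 0, -1, 0]

namespace IsAdaptedFrameOn

theorem apply_one (he : IsAdaptedFrameOn J U e) (hJ : IsAlmostHermitian J) (hy : y ∈ U) :
    J y (e 1 y) = -e 0 y := by
  rw [← he.apply_zero y hy, hJ.apply_apply]

theorem apply_three (he : IsAdaptedFrameOn J U e) (hJ : IsAlmostHermitian J) (hy : y ∈ U) :
    J y (e 3 y) = -e 2 y := by
  rw [← he.apply_two y hy, hJ.apply_apply]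

theorem fundForm_eq (he : IsAdaptedFrameOn J U e) (hJ : IsAlmostHermitian J) (hy : y ∈ U)
    (i j : Fin 4) : fundForm J y (e i y) (e j y) = stdForm i j := by
  have h := he.inner_eq hy
  fin_cases i <;>
    simp [fundForm, he.apply_zero y hy, he.apply_two y hy, he.apply_one hJ hy,
      he.apply_three hJ hy, h] <;>
    fin_cases j <;> simp [stdForm]

/-- The right-hand side is 2⟨R(Ω), Ω⟩ with Ω = e₀∧e₁ + e₂∧e₃. -/
theorem scalStar_eq (he : IsAdaptedFrameOn J U e) (hJ : IsAlmostHermitian J) (hy : y ∈ U) :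
    scalStar J y =
      2 * riemComp e 0 1 0 1 y + 4 * riemComp e 0 1 2 3 y + 2 * riemComp e 2 3 2 3 y := by
  have hR := he.isBilin_riem_right hy
  have hc : IsBilin (ricStar J y) := by
    have h := isBilin_curvOp hR (fundForm J y)
    constructor <;> intros <;>
      simp only [ricStar, map_add, map_smul, h.add_left, h.smul_left, h.add_right, h.smul_right] <;>
      ring
  have hs := he.riemComp_skew_right hy
  have hl := he.riemComp_skew_left hy
  have hn : ∀ u v w z, riem I y u v (-w) z = -riem I y u v w z :=
    fun u v w z ↦ (hR u v).neg_left w z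
  rw [scalStar, he.sum_frame hy hc]
  simp only [ricStar, he.curvOp_eq hy (he.isBilin_riem_left hy) isBilin_fundForm,
    he.fundForm_eq hJ hy, Fin.sum_univ_four, he.apply_zero y hy, he.apply_two y hy,
    he.apply_one hJ hy, he.apply_three hJ hy, hn]
  simp only [← riemComp.eq_def]
  simp [stdForm]
  rw [hl 1 0, hl 1 0, hl 1 0, hl 1 0, hl 3 2, hl 3 2, hl 3 2, hl 3 2, hs _ _ 1 0, hs _ _ 1 0,
    hs _ _ 3 2, hs _ _ 3 2, he.riemComp_pair hy 2 3 0 1]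
  ring

theorem selfDualPart_fundForm (he : IsAdaptedFrameOn J U e) (hJ : IsAlmostHermitian J)
    (hy : y ∈ U) (i j : Fin 4) :
    selfDualPart J y (fundForm J y) (e i y) (e j y) = stdForm i j := by
  rw [selfDualPart, he.hodgeStar_eq hy isBilin_fundForm]
  simp only [volForm, he.fundForm_eq hJ hy]
  fin_cases i <;> fin_cases j <;> simp [Fin.sum_univ_four, stdForm] <;> norm_num

/-- Projection to self-dual forms is symmetric and fixes Ω, so it does not affect the pairing with
Ω. Skew-symmetry of φ is not assumed, hence four terms instead of two. -/
theorem formInner_selfDualPart (he : IsAdaptedFrameOn J U e) (hJ : IsAlmostHermitian J)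
    (hy : y ∈ U) {φ : TangentSpace I y → TangentSpace I y → ℝ} (hφ : IsBilin φ) :
    formInner I y (selfDualPart J y φ) (fundForm J y) =
      (1 / 2) * (φ (e 0 y) (e 1 y) - φ (e 1 y) (e 0 y) + φ (e 2 y) (e 3 y) - φ (e 3 y) (e 2 y)) := by
  rw [he.formInner_eq hy (isBilin_selfDualPart hφ) isBilin_fundForm]
  simp only [selfDualPart, he.hodgeStar_eq hy hφ, volForm, he.fundForm_eq hJ hy]
  simp [Fin.sum_univ_four, stdForm]
  ring

theorem conformalScal_eq (he : IsAdaptedFrameOn J U e) (hJ : IsAlmostHermitian J) (hy : y ∈ U) :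
    conformalScal J y = (3 * scalStar J y - scal I y) / 2 := by
  have hs := he.riemComp_skew_right hy
  have hl := he.riemComp_skew_left hy
  have htr : scal I y = ric I y (e 0 y) (e 0 y) + ric I y (e 1 y) (e 1 y) + ric I y (e 2 y) (e 2 y)
      + ric I y (e 3 y) (e 3 y) := by
    rw [scal, he.sum_frame hy (he.isBilin_ric hy), Fin.sum_univ_four]
  rw [conformalScal, weylPlus,
    he.formInner_selfDualPart hJ hy (isBilin_curvOp (he.isBilin_weyl_right hy) _),
    he.scalStar_eq hJ hy]
  simp only [he.curvOp_eq hy (he.isBilin_weyl_left hy) (isBilin_selfDualPart isBilin_fundForm),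
    he.selfDualPart_fundForm hJ hy, Fin.sum_univ_four]
  simp only [weyl, kulkarniNomizu, he.inner_eq hy, ricZero]
  simp only [← riemComp.eq_def]
  simp [stdForm]
  rw [hl 1 0, hl 1 0, hl 1 0, hl 1 0, hl 3 2, hl 3 2, hl 3 2, hl 3 2, hs _ _ 1 0, hs _ _ 1 0,
    hs _ _ 3 2, hs _ _ 3 2, he.riemComp_pair hy 2 3 0 1]
  -- The Ricci part of the Weyl tensor contributes to the pairing only the trace of Ric₀, which
  -- `htr` makes zero.
  linear_combination (3 / 2 : ℝ) * htr

end IsAdaptedFrameOn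

end PointwiseTraces

/-! ### The tensor ∇Ω, the Lee form and |∇J|² through the 1-forms B and C. -/

section NablaJ

variable {E : Type*} [NormedAddCommGroup E] [NormedSpace ℝ E]
  {H : Type*} [TopologicalSpace H] {I : ModelWithCorners ℝ E H}
  {M : Type*} [TopologicalSpace M] [ChartedSpace H M] [IsManifold I ∞ M]
  [RiemannianBundle (fun x : M ↦ TangentSpace I x)]
  [FiniteDimensional ℝ E]
  [IsContMDiffRiemannianBundle I ∞ E (fun x : M ↦ TangentSpace I x)]
  {J : Π x : M, TangentSpace I x →L[ℝ] TangentSpace I x}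
  {U : Set M} {e : Fin 4 → Π x : M, TangentSpace I x} {y : M}

/-- The tensor `∇Ω` evaluated on vector fields. -/
def nablaFundFormField (J : Π x : M, TangentSpace I x →L[ℝ] TangentSpace I x)
    (X Y Z : Π x : M, TangentSpace I x) (y : M) : ℝ :=
  mvfderiv I (fun z ↦ fundForm J z (Y z) (Z z)) y (X y)
    - fundForm J y (covDeriv X Y y) (Z y) - fundForm J y (Y y) (covDeriv X Z y)

theorem nablaFundFormField_eq_inner (hJ : IsAlmostHermitian J) {X Y Z : Π x : M, TangentSpace I x}
    (hX : SmoothFieldOn U X) (hY : SmoothFieldOn U Y) (hZ : SmoothFieldOn U Z) (hy : y ∈ U) :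
    nablaFundFormField J X Y Z y =
      inner ℝ (covDeriv X (fun z ↦ J z (Y z)) y - J y (covDeriv X Y y)) (Z y) := by
  have h := mvfderiv_inner hX (hJ.smoothFieldOn hY) hZ hy
  simp only [nablaFundFormField, inner_sub_left, fundForm]
  linarith

theorem nablaFundFormField_skew (hJ : IsAlmostHermitian J) {X Y Z : Π x : M, TangentSpace I x} :
    nablaFundFormField J X Y Z y = -nablaFundFormField J X Z Y y := by
  have hs : ∀ (z : M) (u v : TangentSpace I z), fundForm J z u v = -fundForm J z v u :=
    fun z u v ↦ by rw [fundForm, fundForm, hJ.inner_apply_left, real_inner_comm]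
  have : (fun z ↦ fundForm J z (Y z) (Z z)) = -fun z ↦ fundForm J z (Z z) (Y z) :=
    funext fun z ↦ hs z _ _
  rw [nablaFundFormField, nablaFundFormField, this, mvfderiv_neg, hs y (covDeriv X Y y),
    hs y (Y y)]
  simp only [neg_apply]
  ring

theorem nablaFundForm_eq_field (x : M) (u v w : TangentSpace I x) :
    nablaFundForm J x u v w = nablaFundFormField J (extend E u) (extend E v) (extend E w) x := by
  simp [nablaFundForm, nablaFundFormField, covDeriv]

theorem nablaFundForm_eq_inner (hJ : IsAlmostHermitian J) (x : M) (u v w : TangentSpace I x) :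
    nablaFundForm J x u v w = inner ℝ (nablaJ J x u v) w := by
  obtain ⟨V₁, o₁, m₁, h₁⟩ := exists_smoothFieldOn_extend x u
  obtain ⟨V₂, o₂, m₂, h₂⟩ := exists_smoothFieldOn_extend x v
  obtain ⟨V₃, o₃, m₃, h₃⟩ := exists_smoothFieldOn_extend x w
  rw [nablaFundForm_eq_field, nablaFundFormField_eq_inner (U := V₁ ∩ (V₂ ∩ V₃)) hJ
    (h₁.mono fun z hz ↦ hz.1) (h₂.mono fun z hz ↦ hz.2.1) (h₃.mono fun z hz ↦ hz.2.2)
    ⟨m₁, m₂, m₃⟩]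
  simp [nablaJ, covDeriv]

theorem nablaFundForm_skew (hJ : IsAlmostHermitian J) (x : M) (u v w : TangentSpace I x) :
    nablaFundForm J x u v w = -nablaFundForm J x u w v := by
  rw [nablaFundForm_eq_field, nablaFundForm_eq_field, nablaFundFormField_skew hJ]

/-- The identity (∇_XΩ)(Y, Z) = g((∇_XJ)Y, Z) shows that Z enters pointwise, and skew-symmetry
transfers this to Y. -/
theorem nablaFundForm_eq (hJ : IsAlmostHermitian J)
    {X Y Z : Π x : M, TangentSpace I x}
    (hX : SmoothFieldOn U X) (hY : SmoothFieldOn U Y) (hZ : SmoothFieldOn U Z) (hy : y ∈ U) :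
    nablaFundForm J y (X y) (Y y) (Z y) = nablaFundFormField J X Y Z y := by
  obtain ⟨V₁, o₁, m₁, h₁⟩ := exists_smoothFieldOn_extend y (Y y)
  obtain ⟨V₂, o₂, m₂, h₂⟩ := exists_smoothFieldOn_extend y (Z y)
  have hm : y ∈ U ∩ (V₁ ∩ V₂) := ⟨hy, m₁, m₂⟩
  have k₁ := h₁.mono (V := U ∩ (V₁ ∩ V₂)) fun z hz ↦ hz.2.1
  have k₂ := h₂.mono (V := U ∩ (V₁ ∩ V₂)) fun z hz ↦ hz.2.2
  have hX := hX.mono (V := U ∩ (V₁ ∩ V₂)) fun z hz ↦ hz.1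
  have hY := hY.mono (V := U ∩ (V₁ ∩ V₂)) fun z hz ↦ hz.1
  have hZ := hZ.mono (V := U ∩ (V₁ ∩ V₂)) fun z hz ↦ hz.1
  rw [nablaFundForm_eq_field]
  calc nablaFundFormField J (extend E (X y)) (extend E (Y y)) (extend E (Z y)) y
      = nablaFundFormField J X (extend E (Y y)) (extend E (Z y)) y := by
        simp [nablaFundFormField, covDeriv]
    _ = nablaFundFormField J X (extend E (Y y)) Z y := by
        rw [nablaFundFormField_eq_inner hJ hX k₁ k₂ hm, nablaFundFormField_eq_inner hJ hX k₁ hZ hm,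
          extend_apply_self]
    _ = nablaFundFormField J X Y Z y := by
        rw [nablaFundFormField_skew hJ, nablaFundFormField_eq_inner hJ hX hZ k₁ hm,
          nablaFundFormField_skew hJ, nablaFundFormField_eq_inner hJ hX hZ hY hm,
          extend_apply_self]

theorem isBilin_nablaFundForm (hJ : IsAlmostHermitian J) (x : M) (w : TangentSpace I x) :
    IsBilin (fun u v ↦ nablaFundForm J x u v w) := by
  have hl : ∀ u u' v, nablaJ J x (u + u') v = nablaJ J x u v + nablaJ J x u' v := fun u u' v ↦ by
    simp only [nablaJ, map_add]; abel
  have hm : ∀ (a : ℝ) u v, nablaJ J x (a • u) v = a • nablaJ J x u v := fun a u v ↦ by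
    simp only [nablaJ, map_smul, smul_sub]
  constructor <;> intros
  · simp only [nablaFundForm_eq_inner hJ, hl, inner_add_left]
  · simp only [nablaFundForm_eq_inner hJ, hm, inner_smul_left]; simp
  · simp only [nablaFundForm_skew hJ _ _ _ w]
    simp only [nablaFundForm_eq_inner hJ, inner_add_right]; ring
  · simp only [nablaFundForm_skew hJ _ _ _ w]
    simp only [nablaFundForm_eq_inner hJ, inner_smul_right]; ring

theorem isBilin_nablaFundForm_odd (hJ : IsAlmostHermitian J) (x : M) (v : TangentSpace I x) :
    IsBilin (fun u w ↦ nablaFundForm J x u v w) := by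
  have h := isBilin_nablaFundForm hJ x v
  constructor <;> intros <;> simp only [nablaFundForm_skew hJ _ _ v]
  · rw [h.add_left]; ring
  · rw [h.smul_left]; ring
  · rw [h.add_right]; ring
  · rw [h.smul_right]; ring

/-- The connection coefficient `⟨∇_{e_i} e₀, e₂⟩ - ⟨∇_{e_i} e₁, e₃⟩`. -/
def connB (e : Fin 4 → Π x : M, TangentSpace I x) (i : Fin 4) (y : M) : ℝ :=
  christoffel e i 0 2 y - christoffel e i 1 3 y

/-- The connection coefficient `⟨∇_{e_i} e₀, e₃⟩ + ⟨∇_{e_i} e₁, e₂⟩`. -/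
def connC (e : Fin 4 → Π x : M, TangentSpace I x) (i : Fin 4) (y : M) : ℝ :=
  christoffel e i 0 3 y + christoffel e i 1 2 y

/-- The components of the self-dual form `e₀ ∧ e₂ - e₁ ∧ e₃` in an adapted frame. -/
def phiForm : Matrix (Fin 4) (Fin 4) ℝ :=
  !![0, 0, 1, 0; 0, 0, 0, -1; -1, 0, 0, 0; 0, 1, 0, 0]

/-- The components of the self-dual form `e₀ ∧ e₃ + e₁ ∧ e₂` in an adapted frame. -/
def psiForm : Matrix (Fin 4) (Fin 4) ℝ :=
  !![0, 0, 0, 1; 0, 0, 1, 0; 0, -1, 0, 0; -1, 0, 0, 0]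

namespace IsAdaptedFrameOn

theorem nablaFundForm_frame (he : IsAdaptedFrameOn J U e) (hJ : IsAlmostHermitian J) (hy : y ∈ U)
    (i j k : Fin 4) :
    nablaFundForm J y (e i y) (e j y) (e k y) =
      -(∑ p, christoffel e i j p y * stdForm p k) - ∑ p, christoffel e i k p y * stdForm j p := by
  haveI : CompleteSpace E := FiniteDimensional.complete ℝ E
  rw [nablaFundForm_eq hJ (he.smooth i) (he.smooth j) (he.smooth k) hy,
    nablaFundFormField, mvfderiv_congr (g := fun _ ↦ stdForm j k) he.isOpen
    (fun z hz ↦ he.fundForm_eq hJ hz j k) hy, mvfderiv_const, he.covDeriv_eq hy, he.covDeriv_eq hy]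
  have hz : (0 : TangentSpace I y →L[ℝ] ℝ) (e i y) = 0 := rfl
  rw [hz, zero_sub]
  congr 1
  · rw [fundForm, map_sum, sum_inner]
    congr 1
    refine Finset.sum_congr rfl fun p _ ↦ ?_
    rw [map_smul, inner_smul_left, ← he.fundForm_eq hJ hy]
    rfl
  · rw [fundForm, inner_sum]
    refine Finset.sum_congr rfl fun p _ ↦ ?_
    rw [inner_smul_right, ← he.fundForm_eq hJ hy]
    rfl

/-- Differentiating J² = −1 shows that ∇_XΩ is J-anti-invariant, hence a combination of φ and ψ. In
the frame this is visible because Ω has constant components. -/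
theorem nablaFundForm_frame_eq (he : IsAdaptedFrameOn J U e) (hJ : IsAlmostHermitian J)
    (hy : y ∈ U) (i j k : Fin 4) :
    nablaFundForm J y (e i y) (e j y) (e k y) =
      connC e i y * phiForm j k - connB e i y * psiForm j k := by
  have hs := he.christoffel_skew hy i
  have h0 : ∀ a, christoffel e i a a y = 0 := fun a ↦ by linarith [hs a a]
  rw [he.nablaFundForm_frame hJ hy, connB, connC]
  simp only [Fin.sum_univ_four]
  rw [← sub_eq_zero]
  fin_cases j <;> fin_cases k <;>
    simp [stdForm, phiForm, psiForm, h0, hs 1 0, hs 2 0, hs 2 1, hs 3 0, hs 3 1, hs 3 2] <;> ring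

theorem codiffFundForm_eq (he : IsAdaptedFrameOn J U e) (hJ : IsAlmostHermitian J) (hy : y ∈ U)
    (Z : TangentSpace I y) :
    codiffFundForm J y Z = -∑ i, nablaFundForm J y (e i y) (e i y) Z := by
  rw [codiffFundForm, he.sum_frame hy (isBilin_nablaFundForm hJ y Z)]

theorem leeForm_add (he : IsAdaptedFrameOn J U e) (hJ : IsAlmostHermitian J) (hy : y ∈ U)
    (X Y : TangentSpace I y) : leeForm J y (X + Y) = leeForm J y X + leeForm J y Y := by
  simp only [leeForm, he.codiffFundForm_eq hJ hy, map_add,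
    (isBilin_nablaFundForm_odd hJ y _).add_right, Finset.sum_add_distrib]
  ring

theorem leeForm_smul (he : IsAdaptedFrameOn J U e) (hJ : IsAlmostHermitian J) (hy : y ∈ U)
    (a : ℝ) (X : TangentSpace I y) : leeForm J y (a • X) = a * leeForm J y X := by
  simp only [leeForm, he.codiffFundForm_eq hJ hy, map_smul,
    (isBilin_nablaFundForm_odd hJ y _).smul_right, ← Finset.mul_sum]
  ring

theorem ricZero_leeVector (he : IsAdaptedFrameOn J U e) (hJ : IsAlmostHermitian J) (hy : y ∈ U)
    (X : TangentSpace I y) :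
    ricZero I y (leeVector J y) X = ∑ i, leeForm J y (e i y) * ricZero I y (e i y) X := by
  have hr := he.isBilin_ricZero hy
  have h : ricZero I y (leeVector J y) X =
      ∑ i, leeForm J y (frame I y i) * ricZero I y (frame I y i) X := by
    let L : TangentSpace I y →ₗ[ℝ] ℝ :=
      { toFun := fun u ↦ ricZero I y u X
        map_add' := fun u v ↦ hr.add_left u v X
        map_smul' := fun a u ↦ hr.smul_left a u X }
    change L (leeVector J y) = _
    rw [leeVector, map_sum]
    simp only [map_smul, smul_eq_mul]
    rfl
  rw [h]
  refine he.sum_frame hy (B := fun u v ↦ leeForm J y u * ricZero I y v X)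
    ⟨fun _ _ _ ↦ ?_, fun _ _ _ ↦ ?_, fun _ _ _ ↦ ?_, fun _ _ _ ↦ ?_⟩
  · rw [he.leeForm_add hJ hy]; ring
  · rw [he.leeForm_smul hJ hy]; ring
  · rw [hr.add_left]; ring
  · rw [hr.smul_left]; ring

theorem leeForm_eq (he : IsAdaptedFrameOn J U e) (hJ : IsAlmostHermitian J) (hy : y ∈ U) :
    leeForm J y (e 0 y) = connC e 3 y + connB e 2 y ∧
      leeForm J y (e 1 y) = connC e 2 y - connB e 3 y ∧
      leeForm J y (e 2 y) = -connC e 1 y - connB e 0 y ∧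
      leeForm J y (e 3 y) = connB e 1 y - connC e 0 y := by
  have hn : ∀ u v w, nablaFundForm J y u v (-w) = -nablaFundForm J y u v w :=
    fun u v w ↦ (isBilin_nablaFundForm_odd hJ y v).neg_right u w
  simp only [leeForm, he.codiffFundForm_eq hJ hy, he.apply_zero y hy, he.apply_two y hy,
    he.apply_one hJ hy, he.apply_three hJ hy, hn, he.nablaFundForm_frame_eq hJ hy,
    Fin.sum_univ_four]
  simp [phiForm, psiForm]
  refine ⟨?_, ?_, ?_, ?_⟩ <;> ring

theorem normSqNablaJ_eq (he : IsAdaptedFrameOn J U e) (hJ : IsAlmostHermitian J) (hy : y ∈ U) :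
    normSqNablaJ J y = ∑ k, ∑ i, ∑ j, nablaFundForm J y (e i y) (e j y) (e k y) ^ 2 := by
  obtain ⟨b, hb⟩ := he.basis y hy
  have h1 : ∀ v : TangentSpace I y, ‖v‖ ^ 2 = ∑ k, (inner ℝ v (e k y) : ℝ) ^ 2 := fun v ↦ by
    simp only [← hb]
    rw [← b.sum_sq_norm_inner_left]
    simp
  simp only [normSqNablaJ, h1, ← nablaFundForm_eq_inner hJ]
  simp only [sq]
  -- The sum over k goes outside because the change of basis in i and j is made with the third
  -- vector fixed.
  rw [Finset.sum_congr rfl fun i _ ↦ Finset.sum_comm, Finset.sum_comm]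
  refine Finset.sum_congr rfl fun k _ ↦ ?_
  exact he.sum_sum_frame hy (isBilin_nablaFundForm hJ y _) (isBilin_nablaFundForm hJ y _)

/-- As tensors φ and ψ are orthogonal and each has four entries ±1, hence the factor 4. -/
theorem normSqNablaJ_eq_sum (he : IsAdaptedFrameOn J U e) (hJ : IsAlmostHermitian J)
    (hy : y ∈ U) : normSqNablaJ J y = 4 * ∑ i, (connB e i y ^ 2 + connC e i y ^ 2) := by
  rw [he.normSqNablaJ_eq hJ hy]
  simp only [he.nablaFundForm_frame_eq hJ hy]
  simp [Fin.sum_univ_four, phiForm, psiForm]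
  ring

/-- Since ∇ is torsion-free, dΩ is the cyclic sum of ∇Ω. The four triples of distinct indices give
four relations, which say exactly that the components in `leeForm_eq` vanish. -/
theorem connC_eq (he : IsAdaptedFrameOn J U e) (hJ : IsAlmostKahler J) (hy : y ∈ U) :
    connC e 0 y = connB e 1 y ∧ connC e 1 y = -connB e 0 y ∧ connC e 2 y = connB e 3 y ∧
      connC e 3 y = -connB e 2 y := by
  have hJ' := hJ.toIsAlmostHermitian
  have key : ∀ i j k, nablaFundForm J y (e i y) (e j y) (e k y)
      + nablaFundForm J y (e j y) (e k y) (e i y) + nablaFundForm J y (e k y) (e i y) (e j y) = 0 := by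
    intro i j k
    have si := he.smooth i
    have sj := he.smooth j
    have sk := he.smooth k
    have h := hJ.closed y _ _ _ (si.mdiffAt hy) (sj.mdiffAt hy) (sk.mdiffAt hy)
    have hs : ∀ (z : M) (u v : TangentSpace I z), fundForm J z u v = -fundForm J z v u :=
      fun z u v ↦ by rw [fundForm, fundForm, hJ'.inner_apply_left, real_inner_comm]
    have hc : (fun z ↦ fundForm J z (e k z) (e i z)) = -fun z ↦ fundForm J z (e i z) (e k z) :=
      funext fun z ↦ hs z _ _
    have hsub : ∀ u v w : TangentSpace I y,
        fundForm J y (u - v) w = fundForm J y u w - fundForm J y v w :=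
      fun u v w ↦ by simp [fundForm, inner_sub_left]
    rw [nablaFundForm_eq hJ' si sj sk hy, nablaFundForm_eq hJ' sj sk si hy,
      nablaFundForm_eq hJ' sk si sj hy, nablaFundFormField, nablaFundFormField, nablaFundFormField,
      hc, mvfderiv_neg, hs y (e j y), hs y (e k y), hs y (e i y)]
    rw [dFundForm, ← covDeriv_sub_covDeriv si sj hy, ← covDeriv_sub_covDeriv si sk hy,
      ← covDeriv_sub_covDeriv sj sk hy, hsub, hsub, hsub] at h
    simp only [neg_apply]
    linarith
  have h1 := key 0 1 2
  have h2 := key 0 1 3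
  have h3 := key 0 2 3
  have h4 := key 1 2 3
  simp only [he.nablaFundForm_frame_eq hJ' hy] at h1 h2 h3 h4
  simp [phiForm, psiForm] at h1 h2 h3 h4
  refine ⟨?_, ?_, ?_, ?_⟩ <;> linarith

end IsAdaptedFrameOn

end NablaJ

/-! ### Gray's condition: the curvature operator is scalar on anti-invariant forms. -/

section Gray

variable {E : Type*} [NormedAddCommGroup E] [NormedSpace ℝ E]
  {H : Type*} [TopologicalSpace H] {I : ModelWithCorners ℝ E H}
  {M : Type*} [TopologicalSpace M] [ChartedSpace H M] [IsManifold I ∞ M]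
  [RiemannianBundle (fun x : M ↦ TangentSpace I x)]
  [FiniteDimensional ℝ E]
  [IsContMDiffRiemannianBundle I ∞ E (fun x : M ↦ TangentSpace I x)]
  {J : Π x : M, TangentSpace I x →L[ℝ] TangentSpace I x}
  {U : Set M} {e : Fin 4 → Π x : M, TangentSpace I x} {y : M}

/-- The eigenvalue of the curvature operator on the `J`-anti-invariant 2-forms. -/
def antiCurv (e : Fin 4 → Π x : M, TangentSpace I x) (y : M) : ℝ :=
  riemComp e 0 2 0 2 y - riemComp e 0 2 1 3 y

namespace IsOrthoFrameOn

/-- Rewriting rules that bring the index pairs of the curvature components into increasing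
order. -/
theorem riemComp_order (he : IsOrthoFrameOn U e) (hy : y ∈ U) :
    (∀ i k l, riemComp e i i k l y = 0) ∧ (∀ i k l, riemComp e k l i i y = 0) ∧
    (∀ k l, riemComp e 1 0 k l y = -riemComp e 0 1 k l y) ∧
    (∀ k l, riemComp e 2 0 k l y = -riemComp e 0 2 k l y) ∧
    (∀ k l, riemComp e 3 0 k l y = -riemComp e 0 3 k l y) ∧
    (∀ k l, riemComp e 2 1 k l y = -riemComp e 1 2 k l y) ∧
    (∀ k l, riemComp e 3 1 k l y = -riemComp e 1 3 k l y) ∧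
    (∀ k l, riemComp e 3 2 k l y = -riemComp e 2 3 k l y) ∧
    (∀ i j, riemComp e i j 1 0 y = -riemComp e i j 0 1 y) ∧
    (∀ i j, riemComp e i j 2 0 y = -riemComp e i j 0 2 y) ∧
    (∀ i j, riemComp e i j 3 0 y = -riemComp e i j 0 3 y) ∧
    (∀ i j, riemComp e i j 2 1 y = -riemComp e i j 1 2 y) ∧
    (∀ i j, riemComp e i j 3 1 y = -riemComp e i j 1 3 y) ∧
    (∀ i j, riemComp e i j 3 2 y = -riemComp e i j 2 3 y) :=
  have hl := he.riemComp_skew_left hy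
  have hr := he.riemComp_skew_right hy
  ⟨fun i k l ↦ by linarith [hl i i k l], fun i k l ↦ by linarith [hr k l i i],
    hl 1 0, hl 2 0, hl 3 0, hl 2 1, hl 3 1, hl 3 2, fun i j ↦ hr i j 1 0, fun i j ↦ hr i j 2 0,
    fun i j ↦ hr i j 3 0, fun i j ↦ hr i j 2 1, fun i j ↦ hr i j 3 1, fun i j ↦ hr i j 3 2⟩

theorem riemComp_order_pair (he : IsOrthoFrameOn U e) (hy : y ∈ U) :
    riemComp e 0 2 0 1 y = riemComp e 0 1 0 2 y ∧ riemComp e 0 3 0 1 y = riemComp e 0 1 0 3 y ∧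
    riemComp e 1 2 0 1 y = riemComp e 0 1 1 2 y ∧ riemComp e 1 3 0 1 y = riemComp e 0 1 1 3 y ∧
    riemComp e 2 3 0 1 y = riemComp e 0 1 2 3 y ∧ riemComp e 0 3 0 2 y = riemComp e 0 2 0 3 y ∧
    riemComp e 1 2 0 2 y = riemComp e 0 2 1 2 y ∧ riemComp e 1 3 0 2 y = riemComp e 0 2 1 3 y ∧
    riemComp e 2 3 0 2 y = riemComp e 0 2 2 3 y ∧ riemComp e 1 2 0 3 y = riemComp e 0 3 1 2 y ∧
    riemComp e 1 3 0 3 y = riemComp e 0 3 1 3 y ∧ riemComp e 2 3 0 3 y = riemComp e 0 3 2 3 y ∧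
    riemComp e 1 3 1 2 y = riemComp e 1 2 1 3 y ∧ riemComp e 2 3 1 2 y = riemComp e 1 2 2 3 y ∧
    riemComp e 2 3 1 3 y = riemComp e 1 3 2 3 y := by
  refine ⟨?_, ?_, ?_, ?_, ?_, ?_, ?_, ?_, ?_, ?_, ?_, ?_, ?_, ?_, ?_⟩ <;>
    exact he.riemComp_pair hy _ _ _ _

end IsOrthoFrameOn

namespace IsAdaptedFrameOn

/-- The relations that Gray's second curvature condition imposes on the curvature components in an
adapted frame. -/
theorem riemComp_gray (he : IsAdaptedFrameOn J U e) (hJ : IsAlmostHermitian J)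
    (hG : SatisfiesG2 J) (hy : y ∈ U) :
    riemComp e 0 1 1 2 y = -riemComp e 0 1 0 3 y ∧ riemComp e 0 1 1 3 y = riemComp e 0 1 0 2 y ∧
    riemComp e 0 2 1 2 y = -riemComp e 0 2 0 3 y ∧ riemComp e 0 3 1 3 y = riemComp e 0 2 0 3 y ∧
    riemComp e 1 2 1 3 y = -riemComp e 0 2 0 3 y ∧ riemComp e 1 3 1 3 y = riemComp e 0 2 0 2 y ∧
    riemComp e 0 3 1 2 y = riemComp e 0 2 1 3 y - riemComp e 0 1 2 3 y ∧
    riemComp e 0 3 0 3 y =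
      riemComp e 0 2 0 2 y - 2 * riemComp e 0 2 1 3 y + riemComp e 0 1 2 3 y ∧
    riemComp e 1 2 1 2 y =
      riemComp e 0 2 0 2 y - 2 * riemComp e 0 2 1 3 y + riemComp e 0 1 2 3 y ∧
    riemComp e 1 2 2 3 y = -riemComp e 0 3 2 3 y ∧ riemComp e 1 3 2 3 y = riemComp e 0 2 2 3 y := by
  have n₃ : ∀ u v w z, riem I y u v (-w) z = -riem I y u v w z :=
    fun u v w z ↦ (he.isBilin_riem_right hy u v).neg_left w z
  have n₂ : ∀ u v w z, riem I y u (-v) w z = -riem I y u v w z :=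
    fun u v w z ↦ (he.isBilin_riem_left hy w z).neg_right u v
  have n₄ : ∀ u v w z, riem I y u v w (-z) = -riem I y u v w z :=
    fun u v w z ↦ (he.isBilin_riem_right hy u v).neg_right w z
  -- It suffices to take X = e₀ and Y = e₂ or e₃, so that X and Y lie in different J-planes. The
  -- formula for R₀₃₁₂ is the first Bianchi identity `hb`.
  have g := fun i j k l ↦ hG y (e i y) (e j y) (e k y) (e l y)
  have g1 := g 0 2 0 1
  have g2 := g 0 2 2 3
  have g3 := g 0 2 0 2
  have g4 := g 0 2 0 3
  have g5 := g 0 2 1 2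
  have g6 := g 0 2 1 3
  have g7 := g 0 3 0 1
  have g8 := g 0 3 2 3
  have g9 := g 0 3 0 2
  have g10 := g 0 3 0 3
  have g11 := g 0 3 1 2
  have g12 := g 0 3 1 3
  have hb := he.riemComp_bianchi hy 0 1 2 3
  simp only [he.apply_zero y hy, he.apply_two y hy, he.apply_one hJ hy, he.apply_three hJ hy,
    n₂, n₃, n₄, ← riemComp.eq_def, he.riemComp_order hy, he.riemComp_order_pair hy]
    at g1 g2 g3 g4 g5 g6 g7 g8 g9 g10 g11 g12 hb
  refine ⟨?_, ?_, ?_, ?_, ?_, ?_, ?_, ?_, ?_, ?_, ?_⟩ <;> linarith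

theorem riemComp_phi (he : IsAdaptedFrameOn J U e) (hJ : IsAlmostHermitian J)
    (hG : SatisfiesG2 J) (hy : y ∈ U) (j k : Fin 4) :
    riemComp e j k 0 2 y - riemComp e j k 1 3 y = phiForm j k * antiCurv e y := by
  rw [antiCurv, ← sub_eq_zero]
  fin_cases j <;> fin_cases k <;>
    simp [phiForm, he.riemComp_order hy, he.riemComp_order_pair hy, he.riemComp_gray hJ hG hy] <;>
    ring

theorem riemComp_psi (he : IsAdaptedFrameOn J U e) (hJ : IsAlmostHermitian J)
    (hG : SatisfiesG2 J) (hy : y ∈ U) (j k : Fin 4) :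
    riemComp e j k 0 3 y + riemComp e j k 1 2 y = psiForm j k * antiCurv e y := by
  rw [antiCurv, ← sub_eq_zero]
  fin_cases j <;> fin_cases k <;>
    simp [psiForm, he.riemComp_order hy, he.riemComp_order_pair hy, he.riemComp_gray hJ hG hy] <;>
    ring

/-- On self-dual forms the curvature operator has trace s/4; the Ω-direction contributes s*/4 and
the plane of φ and ψ contributes 2λ. -/
theorem scal_sub_scalStar (he : IsAdaptedFrameOn J U e) (hJ : IsAlmostHermitian J)
    (hG : SatisfiesG2 J) (hy : y ∈ U) : scal I y - scalStar J y = 8 * antiCurv e y := by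
  rw [he.scalStar_eq hJ hy, he.scal_eq hy, antiCurv]
  simp only [Fin.sum_univ_four, he.riemComp_order hy,
    he.riemComp_gray hJ hG hy]
  ring

theorem smooth_antiCurv (he : IsAdaptedFrameOn J U e) : SmoothFunOn I U (antiCurv e) :=
  (he.smooth_riemComp 0 2 0 2).sub (he.smooth_riemComp 0 2 1 3)

/-- The eigenvalue equation holds on all of U and φ has constant components, so the equation can be
differentiated. -/
theorem frameDeriv_phi (he : IsAdaptedFrameOn J U e) (hJ : IsAlmostHermitian J)
    (hG : SatisfiesG2 J) (hy : y ∈ U) (i j k : Fin 4) :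
    frameDeriv e i (riemComp e j k 0 2) y - frameDeriv e i (riemComp e j k 1 3) y =
      phiForm j k * frameDeriv e i (antiCurv e) y := by
  have h := frameDeriv_congr (e := e) he.isOpen (fun z hz ↦ he.riemComp_phi hJ hG hz j k) hy i
  rw [frameDeriv, mvfderiv_fun_sub ((he.smooth_riemComp j k 0 2).mdiffAt hy)
    ((he.smooth_riemComp j k 1 3).mdiffAt hy), frameDeriv,
    mvfderiv_fun_mul mdifferentiableAt_const (he.smooth_antiCurv.mdiffAt hy)] at h
  simpa [mvfderiv_const, frameDeriv] using h

theorem frameDeriv_psi (he : IsAdaptedFrameOn J U e) (hJ : IsAlmostHermitian J)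
    (hG : SatisfiesG2 J) (hy : y ∈ U) (i j k : Fin 4) :
    frameDeriv e i (riemComp e j k 0 3) y + frameDeriv e i (riemComp e j k 1 2) y =
      psiForm j k * frameDeriv e i (antiCurv e) y := by
  have h := frameDeriv_congr (e := e) he.isOpen (fun z hz ↦ he.riemComp_psi hJ hG hz j k) hy i
  rw [frameDeriv, mvfderiv_fun_add ((he.smooth_riemComp j k 0 3).mdiffAt hy)
    ((he.smooth_riemComp j k 1 2).mdiffAt hy), frameDeriv,
    mvfderiv_fun_mul mdifferentiableAt_const (he.smooth_antiCurv.mdiffAt hy)] at h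
  simpa [mvfderiv_const, frameDeriv] using h

end IsAdaptedFrameOn

end Gray

/-! ### The differential of s − s*, and |∇J|² in the almost Kähler case. -/

section Main

variable {E : Type*} [NormedAddCommGroup E] [NormedSpace ℝ E]
  {H : Type*} [TopologicalSpace H] {I : ModelWithCorners ℝ E H}
  {M : Type*} [TopologicalSpace M] [ChartedSpace H M] [IsManifold I ∞ M]
  [RiemannianBundle (fun x : M ↦ TangentSpace I x)]
  [FiniteDimensional ℝ E]
  [IsContMDiffRiemannianBundle I ∞ E (fun x : M ↦ TangentSpace I x)]
  {J : Π x : M, TangentSpace I x →L[ℝ] TangentSpace I x}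
  {U : Set M} {e : Fin 4 → Π x : M, TangentSpace I x} {y : M}

theorem IsOrthoFrameOn.christoffel_order (he : IsOrthoFrameOn U e) (hy : y ∈ U) :
    (∀ i j, christoffel e i j j y = 0) ∧
    (∀ i, christoffel e i 1 0 y = -christoffel e i 0 1 y) ∧
    (∀ i, christoffel e i 2 0 y = -christoffel e i 0 2 y) ∧
    (∀ i, christoffel e i 3 0 y = -christoffel e i 0 3 y) ∧
    (∀ i, christoffel e i 2 1 y = -christoffel e i 1 2 y) ∧
    (∀ i, christoffel e i 3 1 y = -christoffel e i 1 3 y) ∧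
    (∀ i, christoffel e i 3 2 y = -christoffel e i 2 3 y) :=
  have h := he.christoffel_skew hy
  ⟨fun i j ↦ by linarith [h i j j], fun i ↦ h i 1 0, fun i ↦ h i 2 0, fun i ↦ h i 3 0,
    fun i ↦ h i 2 1, fun i ↦ h i 3 1, fun i ↦ h i 3 2⟩

namespace IsAdaptedFrameOn

theorem frameDeriv_antiCurv (he : IsAdaptedFrameOn J U e) (hJ : IsAlmostHermitian J)
    (hG : SatisfiesG2 J) (hy : y ∈ U) (l : Fin 4) :
    8 * frameDeriv e l (antiCurv e) y - conformalScal J y * leeForm J y (e l y) =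
      4 * ricZero I y (leeVector J y) (e l y) := by
  have bs := he.bianchi_second hy
  have fphi := he.frameDeriv_phi hJ hG hy
  have fpsi := he.frameDeriv_psi hJ hG hy
  obtain ⟨t0, t1, t2, t3⟩ := he.leeForm_eq hJ hy
  have rz : ∀ i, ricZero I y (e i y) (e l y) = ∑ p, riemComp e p i p l y
      - scal I y / 4 * if i = l then 1 else 0 := fun i ↦ by
    rw [ricZero, he.ric_eq hy, he.inner_eq hy]
    rfl
  rw [he.ricZero_leeVector hJ hy, he.conformalScal_eq hJ hy, he.scalStar_eq hJ hy]
  simp only [rz, he.scal_eq hy]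
  simp only [Fin.sum_univ_four, t0, t1, t2, t3, connB, connC]
  -- For each l, `p - p'` pairs the second Bianchi identity with φ on a triple where dλ∧φ reduces to
  -- ±e_l(λ), and `q + q'` does the same with ψ. The equations `u` and `v` replace derivatives of
  -- the curvature by derivatives of λ. Each pairing yields 4e_l(λ) after multiplication by ±4,
  -- whence the coefficient 8; the φ-identity brings in C and the ψ-identity brings in B.
  fin_cases l
  · have p := bs 0 1 3 0 2
    have p' := bs 0 1 3 1 3
    have q := bs 0 1 2 0 3
    have q' := bs 0 1 2 1 2
    have u₁ := fphi 0 1 3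
    have u₂ := fphi 1 3 0
    have u₃ := fphi 3 0 1
    have v₁ := fpsi 0 1 2
    have v₂ := fpsi 1 2 0
    have v₃ := fpsi 2 0 1
    simp [phiForm, psiForm] at u₁ u₂ u₃ v₁ v₂ v₃
    simp only [Fin.sum_univ_four, he.riemComp_order hy, he.riemComp_order_pair hy,
      he.riemComp_gray hJ hG hy, he.christoffel_order hy] at p p' q q'
    simp [t0, connB, connC, he.riemComp_order hy, he.riemComp_order_pair hy,
      he.riemComp_gray hJ hG hy]
    linear_combination 4 * (q + q' - v₁ - v₂ - v₃) - 4 * (p - p' - u₁ - u₂ - u₃)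
  · have p := bs 0 1 2 0 2
    have p' := bs 0 1 2 1 3
    have q := bs 0 1 3 0 3
    have q' := bs 0 1 3 1 2
    have u₁ := fphi 0 1 2
    have u₂ := fphi 1 2 0
    have u₃ := fphi 2 0 1
    have v₁ := fpsi 0 1 3
    have v₂ := fpsi 1 3 0
    have v₃ := fpsi 3 0 1
    simp [phiForm, psiForm] at u₁ u₂ u₃ v₁ v₂ v₃
    simp only [Fin.sum_univ_four, he.riemComp_order hy, he.riemComp_order_pair hy,
      he.riemComp_gray hJ hG hy, he.christoffel_order hy] at p p' q q'
    simp [t1, connB, connC, he.riemComp_order hy, he.riemComp_order_pair hy,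
      he.riemComp_gray hJ hG hy]
    linear_combination -4 * (q + q' - v₁ - v₂ - v₃) - 4 * (p - p' - u₁ - u₂ - u₃)
  · have p := bs 1 2 3 0 2
    have p' := bs 1 2 3 1 3
    have q := bs 0 2 3 0 3
    have q' := bs 0 2 3 1 2
    have u₁ := fphi 1 2 3
    have u₂ := fphi 2 3 1
    have u₃ := fphi 3 1 2
    have v₁ := fpsi 0 2 3
    have v₂ := fpsi 2 3 0
    have v₃ := fpsi 3 0 2
    simp [phiForm, psiForm] at u₁ u₂ u₃ v₁ v₂ v₃
    simp only [Fin.sum_univ_four, he.riemComp_order hy, he.riemComp_order_pair hy,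
      he.riemComp_gray hJ hG hy, he.christoffel_order hy] at p p' q q'
    simp [t2, connB, connC, he.riemComp_order hy, he.riemComp_order_pair hy,
      he.riemComp_gray hJ hG hy]
    linear_combination -4 * (q + q' - v₁ - v₂ - v₃) + 4 * (p - p' - u₁ - u₂ - u₃)
  · have p := bs 0 2 3 0 2
    have p' := bs 0 2 3 1 3
    have q := bs 1 2 3 0 3
    have q' := bs 1 2 3 1 2
    have u₁ := fphi 0 2 3
    have u₂ := fphi 2 3 0
    have u₃ := fphi 3 0 2
    have v₁ := fpsi 1 2 3
    have v₂ := fpsi 2 3 1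
    have v₃ := fpsi 3 1 2
    simp [phiForm, psiForm] at u₁ u₂ u₃ v₁ v₂ v₃
    simp only [Fin.sum_univ_four, he.riemComp_order hy, he.riemComp_order_pair hy,
      he.riemComp_gray hJ hG hy, he.christoffel_order hy] at p p' q q'
    simp [t3, connB, connC, he.riemComp_order hy, he.riemComp_gray hJ hG hy]
    linear_combination 4 * (q + q' - v₁ - v₂ - v₃) + 4 * (p - p' - u₁ - u₂ - u₃)

/-- On an almost Kähler manifold, the norm of `∇J` is determined by the curvature. -/
theorem normSqNablaJ_eq_antiCurv (he : IsAdaptedFrameOn J U e) (hJ : IsAlmostKahler J)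
    (hG : SatisfiesG2 J) (hy : y ∈ U) : normSqNablaJ J y = -16 * antiCurv e y := by
  have hJ' := hJ.toIsAlmostHermitian
  have db : ∀ i j, frameDeriv e i (connB e j) y = frameDeriv e i (christoffel e j 0 2) y
      - frameDeriv e i (christoffel e j 1 3) y := fun i j ↦ by
    have := mvfderiv_fun_sub ((he.smooth_christoffel j 0 2).mdiffAt hy)
      ((he.smooth_christoffel j 1 3).mdiffAt hy)
    exact congrArg (fun L ↦ L (e i y)) this
  have dc : ∀ i j, frameDeriv e i (connC e j) y = frameDeriv e i (christoffel e j 0 3) y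
      + frameDeriv e i (christoffel e j 1 2) y := fun i j ↦
    frameDeriv_add (he.smooth_christoffel j 0 3) (he.smooth_christoffel j 1 2) hy i
  have d₀ : ∀ i, frameDeriv e i (connC e 0) y = frameDeriv e i (connB e 1) y := fun i ↦
    frameDeriv_congr he.isOpen (fun z hz ↦ (he.connC_eq hJ hz).1) hy i
  have d₁ : ∀ i, frameDeriv e i (connC e 1) y = -frameDeriv e i (connB e 0) y := fun i ↦ by
    rw [← frameDeriv_neg]
    exact frameDeriv_congr he.isOpen (fun z hz ↦ (he.connC_eq hJ hz).2.1) hy i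
  have d₂ : ∀ i, frameDeriv e i (connC e 2) y = frameDeriv e i (connB e 3) y := fun i ↦
    frameDeriv_congr he.isOpen (fun z hz ↦ (he.connC_eq hJ hz).2.2.1) hy i
  have d₃ : ∀ i, frameDeriv e i (connC e 3) y = -frameDeriv e i (connB e 2) y := fun i ↦ by
    rw [← frameDeriv_neg]
    exact frameDeriv_congr he.isOpen (fun z hz ↦ (he.connC_eq hJ hz).2.2.2) hy i
  obtain ⟨k₀, k₁, k₂, k₃⟩ := he.connC_eq hJ hy
  have p₁ := he.riemComp_phi hJ' hG hy 0 2
  have p₂ := he.riemComp_phi hJ' hG hy 1 3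
  have p₃ := he.riemComp_psi hJ' hG hy 0 3
  have p₄ := he.riemComp_psi hJ' hG hy 1 2
  -- The sum p₁ − p₂ + p₃ + p₄ contains −e₀(B₂ + C₃) + e₃(C₀ − B₁) + e₁(B₃ − C₂) + e₂(B₀ + C₁).
  -- These four derivatives of the relations in `connC_eq` are zero.
  have f₁ := d₃ 0
  have f₂ := d₀ 3
  have f₃ := d₂ 1
  have f₄ := d₁ 2
  rw [he.normSqNablaJ_eq_sum hJ' hy, Fin.sum_univ_four, k₀, k₁, k₂, k₃]
  simp only [db, dc] at f₁ f₂ f₃ f₄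
  simp [phiForm, psiForm] at p₁ p₂ p₃ p₄
  simp only [he.riemComp_eq hy, Fin.sum_univ_four, he.christoffel_order hy] at p₁ p₂ p₃ p₄
  -- Eliminating the coefficients of types 02 and 03 through B leaves frame-dependent coefficients,
  -- which cancel in the final combination, and the squares of B.
  have w₀ : christoffel e 0 0 3 y = connB e 1 y - christoffel e 0 1 2 y := by
    rw [← k₀, connC]; ring
  have w₁ : christoffel e 1 0 3 y = -connB e 0 y - christoffel e 1 1 2 y := by
    rw [← k₁, connC]; ring
  have w₂ : christoffel e 2 0 3 y = connB e 3 y - christoffel e 2 1 2 y := by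
    rw [← k₂, connC]; ring
  have w₃ : christoffel e 3 0 3 y = -connB e 2 y - christoffel e 3 1 2 y := by
    rw [← k₃, connC]; ring
  have x : ∀ i, christoffel e i 0 2 y = connB e i y + christoffel e i 1 3 y := fun i ↦ by
    rw [connB]; ring
  simp only [w₀, w₁, w₂, w₃, x] at p₁ p₂ p₃ p₄
  linear_combination -4 * (p₁ - p₂ + p₃ + p₄) + 4 * (-f₁ + f₂ - f₃ + f₄)

end IsAdaptedFrameOn

end Main

/-! ### Vanishing derivative implies local constancy. -/

/-- A differentiable function with vanishing derivative on a manifold without boundary is locally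
constant. -/
theorem isLocallyConstant_of_mvfderiv_eq_zero {E : Type*} [NormedAddCommGroup E] [NormedSpace ℝ E]
    {H : Type*} [TopologicalSpace H] {I : ModelWithCorners ℝ E H} [I.Boundaryless]
    {M : Type*} [TopologicalSpace M] [ChartedSpace H M] [IsManifold I 1 M] {f : M → ℝ}
    (hf : MDifferentiable I 𝓘(ℝ, ℝ) f) (h0 : ∀ x, mvfderiv I f x = 0) : IsLocallyConstant f := by
  rw [IsLocallyConstant.iff_eventually_eq]
  intro x
  have ho : IsOpen (extChartAt I x).target := isOpen_extChartAt_target x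
  have hd : ∀ z ∈ (extChartAt I x).target,
      HasFDerivAt (f ∘ (extChartAt I x).symm) (0 : E →L[ℝ] ℝ) z := by
    intro z hz
    have hs : MDifferentiableAt 𝓘(ℝ, E) I (extChartAt I x).symm z :=
      ((contMDiffOn_extChartAt_symm (n := 1) x).contMDiffAt (ho.mem_nhds hz)).mdifferentiableAt
        (by simp)
    have h := (hf ((extChartAt I x).symm z)).hasMFDerivAt.comp z hs.hasMFDerivAt
    have h1 : mfderiv I 𝓘(ℝ, ℝ) f ((extChartAt I x).symm z) = 0 := by
      ext v
      exact congrArg (fun L ↦ L v) (h0 ((extChartAt I x).symm z))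
    rw [h1, ContinuousLinearMap.zero_comp] at h
    exact h.hasFDerivAt
  obtain ⟨r, hr, hb⟩ := Metric.isOpen_iff.1 ho _ (mem_extChartAt_target x)
  have hc : ∀ z ∈ Metric.ball (extChartAt I x x) r,
      f ((extChartAt I x).symm z) = f ((extChartAt I x).symm (extChartAt I x x)) := fun z hz ↦
    Metric.isOpen_ball.is_const_of_fderiv_eq_zero (f := f ∘ (extChartAt I x).symm)
      (convex_ball _ _).isPreconnected
      (fun w hw ↦ (hd w (hb hw)).differentiableAt.differentiableWithinAt)
      (fun w hw ↦ (hd w (hb hw)).fderiv) hz (Metric.mem_ball_self hr)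
  filter_upwards [extChartAt_source_mem_nhds (I := I) x,
    (continuousAt_extChartAt (I := I) x).preimage_mem_nhds (Metric.ball_mem_nhds _ hr)] with w hw hw'
  have := hc _ hw'
  rwa [(extChartAt I x).left_inv hw, extChartAt_to_inv] at this

/-! ### From frames to the manifold. -/

section Main

variable {E : Type*} [NormedAddCommGroup E] [NormedSpace ℝ E]
  {H : Type*} [TopologicalSpace H] {I : ModelWithCorners ℝ E H}
  {M : Type*} [TopologicalSpace M] [ChartedSpace H M] [IsManifold I ∞ M]
  [RiemannianBundle (fun x : M ↦ TangentSpace I x)]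
  [FiniteDimensional ℝ E]
  [IsContMDiffRiemannianBundle I ∞ E (fun x : M ↦ TangentSpace I x)]
  {J : Π x : M, TangentSpace I x →L[ℝ] TangentSpace I x}

theorem mdifferentiable_scal_sub_scalStar (h4 : finrank ℝ E = 4) (hJ : IsAlmostHermitian J)
    (hG : SatisfiesG2 J) :
    MDifferentiable I 𝓘(ℝ, ℝ) (fun x : M ↦ scal I x - scalStar J x) := fun x ↦ by
  obtain ⟨U, e, hx, he⟩ := hJ.exists_adaptedFrame h4 x
  have hs : SmoothFunOn I U (fun x : M ↦ scal I x - scalStar J x) :=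
    ((SmoothFunOn.const 8).mul he.smooth_antiCurv).congr he.isOpen
      fun y hy ↦ he.scal_sub_scalStar hJ hG hy
  exact hs.mdiffAt hx

/-- Both sides are linear in X, so `frameDeriv_antiCurv` on the frame vectors is enough. -/
theorem mvfderiv_scal_sub_scalStar (h4 : finrank ℝ E = 4) (hJ : IsAlmostHermitian J)
    (hG : SatisfiesG2 J) (x : M) (X : TangentSpace I x) :
    mvfderiv I (fun y : M ↦ scal I y - scalStar J y) x X - conformalScal J x * leeForm J x X
      = 4 * ricZero I x (leeVector J x) X := by
  haveI : CompleteSpace E := FiniteDimensional.complete ℝ E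
  obtain ⟨U, e, hx, he⟩ := hJ.exists_adaptedFrame h4 x
  have hd : ∀ v, mvfderiv I (fun y : M ↦ scal I y - scalStar J y) x v =
      8 * mvfderiv I (antiCurv e) x v := fun v ↦ by
    rw [mvfderiv_congr he.isOpen (fun y hy ↦ he.scal_sub_scalStar hJ hG hy) hx,
      mvfderiv_fun_mul mdifferentiableAt_const (he.smooth_antiCurv.mdiffAt hx)]
    simp [mvfderiv_const]
  have hr := he.isBilin_ricZero hx
  let A : TangentSpace I x →ₗ[ℝ] ℝ :=
    { toFun := fun v ↦ 8 * mvfderiv I (antiCurv e) x v - conformalScal J x * leeForm J x v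
      map_add' := fun v w ↦ by rw [map_add, he.leeForm_add hJ hx]; ring
      map_smul' := fun a v ↦ by
        rw [map_smul, he.leeForm_smul hJ hx]; simp only [smul_eq_mul, RingHom.id_apply]; ring }
  let B : TangentSpace I x →ₗ[ℝ] ℝ :=
    { toFun := fun v ↦ 4 * ricZero I x (leeVector J x) v
      map_add' := fun v w ↦ by rw [hr.add_right]; ring
      map_smul' := fun a v ↦ by
        rw [hr.smul_right]; simp only [smul_eq_mul, RingHom.id_apply]; ring }
  rw [hd]
  change A X = B X
  rw [← he.sum_inner_smul hx X]
  simp only [map_sum, map_smul]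
  exact Finset.sum_congr rfl fun i _ ↦ congrArg _ (he.frameDeriv_antiCurv hJ hG hx i)

theorem normSqNablaJ_eq_scalStar_sub_scal (h4 : finrank ℝ E = 4) (hJ : IsAlmostKahler J)
    (hG : SatisfiesG2 J) (x : M) : normSqNablaJ J x = 2 * (scalStar J x - scal I x) := by
  obtain ⟨U, e, hx, he⟩ := hJ.toIsAlmostHermitian.exists_adaptedFrame h4 x
  linarith [he.normSqNablaJ_eq_antiCurv hJ hG hx, he.scal_sub_scalStar hJ.toIsAlmostHermitian hG hx]

theorem IsAlmostKahler.leeForm_eq_zero (h4 : finrank ℝ E = 4) (hJ : IsAlmostKahler J) (x : M)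
    (X : TangentSpace I x) : leeForm J x X = 0 := by
  have hJ' := hJ.toIsAlmostHermitian
  obtain ⟨U, e, hx, he⟩ := hJ'.exists_adaptedFrame h4 x
  obtain ⟨t0, t1, t2, t3⟩ := he.leeForm_eq hJ' hx
  obtain ⟨k0, k1, k2, k3⟩ := he.connC_eq hJ hx
  rw [← he.sum_inner_smul hx X]
  simp only [Fin.sum_univ_four, he.leeForm_add hJ' hx, he.leeForm_smul hJ' hx, t0, t1, t2, t3,
    k0, k1, k2, k3]
  ring

/-- With θ = 0 both the κθ term and the Ric₀(θ) term of the general formula disappear. -/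
theorem IsAlmostKahler.mvfderiv_scal_sub_scalStar (h4 : finrank ℝ E = 4) (hJ : IsAlmostKahler J)
    (hG : SatisfiesG2 J) (x : M) :
    mvfderiv I (fun y : M ↦ scal I y - scalStar J y) x = 0 := by
  ext X
  have h := AlmostHermitian.mvfderiv_scal_sub_scalStar h4 hJ.toIsAlmostHermitian hG x X
  obtain ⟨U, e, hx, he⟩ := hJ.toIsAlmostHermitian.exists_adaptedFrame h4 x
  rw [he.ricZero_leeVector hJ.toIsAlmostHermitian hx] at h
  simpa [hJ.leeForm_eq_zero h4] using h

end Main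

end AlmostHermitian

end

open AlmostHermitian

theorem proposition1
    {M : Type*} [TopologicalSpace M] [T2Space M]
    [ChartedSpace (EuclideanSpace ℝ (Fin 4)) M] [IsManifold (𝓡 4) ∞ M]
    [RiemannianBundle (fun x : M ↦ TangentSpace (𝓡 4) x)]
    [IsContMDiffRiemannianBundle (𝓡 4) ∞ (EuclideanSpace ℝ (Fin 4))
      (fun x : M ↦ TangentSpace (𝓡 4) x)]
    (J : Π x : M, TangentSpace (𝓡 4) x →L[ℝ] TangentSpace (𝓡 4) x)
    (hJ : IsAlmostHermitian J) (hG2 : SatisfiesG2 J) :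
    (MDifferentiable (𝓡 4) 𝓘(ℝ, ℝ) (fun x : M ↦ scal (𝓡 4) x - scalStar J x) ∧
      ∀ (x : M) (X : TangentSpace (𝓡 4) x),
        mvfderiv (𝓡 4) (fun y : M ↦ scal (𝓡 4) y - scalStar J y) x X
            - conformalScal J x * leeForm J x X
          = 4 * ricZero (𝓡 4) x (leeVector J x) X) ∧
    (IsAlmostKahler J →
      (∀ x : M, normSqNablaJ J x = 2 * (scalStar J x - scal (𝓡 4) x)) ∧
      (PreconnectedSpace M → ∃ c : ℝ, ∀ x : M, normSqNablaJ J x = c)) := by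
  have h4 : finrank ℝ (EuclideanSpace ℝ (Fin 4)) = 4 := by simp
  have hM : IsManifold (𝓡 4) 1 M := by exact_mod_cast isManifold_nat (I := 𝓡 4) (M := M) 1
  have hd := mdifferentiable_scal_sub_scalStar h4 hJ hG2
  refine ⟨⟨hd, mvfderiv_scal_sub_scalStar h4 hJ hG2⟩, fun hK ↦ ?_⟩
  have hn := normSqNablaJ_eq_scalStar_sub_scal h4 hK hG2
  refine ⟨hn, fun _ ↦ ?_⟩
  -- A preconnected space may be empty, and then any constant serves.
  rcases isEmpty_or_nonempty M with hE | ⟨⟨x₀⟩⟩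
  · exact ⟨0, fun x ↦ hE.elim x⟩
  · have hc := isLocallyConstant_of_mvfderiv_eq_zero hd (hK.mvfderiv_scal_sub_scalStar h4 hG2)
    refine ⟨normSqNablaJ J x₀, fun x ↦ ?_⟩
    rw [hn, hn]
    have := hc.apply_eq_of_preconnectedSpace x x₀
    linarith
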